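/- Let $n\in\mathbb N$, let $\Omega\subset\mathbb R^n$ be a bounded open set with $C^{1,1}$ boundary, let $M\in\mathbb R^{n\times n}$, and let $K\subset\mathbb R^{n\times n}$ be nonempty and compact (for instance a finite union of energy wells $K=\bigcup_{j=1}^m SO(n)U_j$, or $K=\alpha\,SO(n)$). For $\epsilon>0$ let $$E_{\epsilon,1}=\inf\Big\{\int_\Omega \operatorname{dist}^2(\nabla u,K)\,dx+\epsilon\,|\nabla^2u|(\Omega)\;:\; u\in W^{1,1}_{loc}(\mathbb R^n;\mathbb R^n),\ \nabla u=M\text{ a.e. in }\mathbb R^n\setminus\overline\Omega\Big\},$$ where $|\nabla^2u|(\Omega)\in[0,\infty]$ is the total variation in $\Omega$ of the distributional derivative of $\nabla u$. Assume that there are constants $C>1$, $\mu\in(0,\tfrac12)$ and $\epsilon_0>0$ such that $$\epsilon^{2\mu}\le C\,E_{\epsilon,1}\qquad\text{for all }\epsilon\in(0,\epsilon_0).$$ Let $u\in W^{1,1}_{loc}(\mathbb R^n;\mathbb R^n)$ satisfy $\nabla u\in K$ a.e. in $\Omega$ and $\nabla u=M$ a.e. in $\mathbb R^n\setminus\overline\Omega$.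 Suppose that for some $b\in\mathbb R^n$ and $s\in\mathbb R$ the function $v(x)=u(x)-Mx-b$ satisfies $v\in B^{1+s}_{1,1}(\mathbb R^n)$, $\operatorname{supp}(v)\subset\overline\Omega$ and $\nabla v\in L^\infty(\mathbb R^n)$. Then $s\le 2\mu$. Here $B^{\sigma}_{1,1}(\mathbb R^n)$ is the space of (tempered) distributions $f$ with $\|f\|_{B^\sigma_{1,1}}=\sum_{N\in 2^{\mathbb Z}}N^{\sigma}\|P_Nf\|_{L^1(\mathbb R^n)}<\infty$ (componentwise for vector-valued $f$), where $P_N$ is the Fourier multiplier with symbol $\varphi(k/N)-\varphi(2k/N)$ and $\varphi$ is any fixed smooth, non-negative, radially symmetric function supported in $\{|k|\le 2\}$ and equal to one on $\{|k|\le 1\}$. -/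

import Mathlib

open MeasureTheory Set
open scoped ENNReal NNReal ContDiff SchwartzMap InnerProductSpace

/-- `ℝⁿ` with its Euclidean structure. -/
abbrev Rn (n : ℕ) : Type := EuclideanSpace ℝ (Fin n)

/-- Real `n × n` matrices. -/
abbrev Mat (n : ℕ) : Type := Matrix (Fin n) (Fin n) ℝ

/-- The `j`-th partial derivative of a real function at `x`. -/
noncomputable def partialDeriv {n : ℕ} (j : Fin n) (φ : Rn n → ℝ) (x : Rn n) : ℝ :=
  fderiv ℝ φ x (EuclideanSpace.single j 1)

/-- `Ω` is an open set with `C^{1,1}` boundary: near every boundary point it is, in a suitable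
direction `e`, the part of a ball lying strictly below the graph of a `C¹` function with Lipschitz
derivative of the coordinates orthogonal to `e`. -/
def IsC11Domain {n : ℕ} (Ω : Set (Rn n)) : Prop :=
  IsOpen Ω ∧ ∀ x₀ ∈ frontier Ω, ∃ (e : Rn n) (r : ℝ) (γ : Rn n → ℝ) (L : ℝ≥0),
    ‖e‖ = 1 ∧ 0 < r ∧ ContDiff ℝ 1 γ ∧ LipschitzWith L (fderiv ℝ γ) ∧
      Ω ∩ Metric.ball x₀ r =
        {x | ⟪e, x⟫_ℝ < γ (x - ⟪e, x⟫_ℝ • e)} ∩ Metric.ball x₀ r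

/-- `u ∈ W^{1,1}_loc(ℝⁿ; ℝⁿ)` with weak gradient `G`, where `G i j = ∂ⱼ uᵢ`. -/
def HasWeakGradient {n : ℕ} (u : Rn n → Rn n) (G : Rn n → Mat n) : Prop :=
  LocallyIntegrable u ∧ (∀ i j, LocallyIntegrable fun x => G x i j) ∧
    ∀ φ : Rn n → ℝ, ContDiff ℝ ∞ φ → HasCompactSupport φ →
      ∀ i j, ∫ x, u x i * partialDeriv j φ x = -∫ x, G x i j * φ x

/-- The total variation `|DG|(Ω) ∈ [0, ∞]` of the distributional derivative of the matrix field
`G` in the open set `Ω`, with respect to the Euclidean norm on `ℝ^{n×n×n}`. -/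
noncomputable def totalVariation {n : ℕ} (G : Rn n → Mat n) (Ω : Set (Rn n)) : ℝ≥0∞ :=
  ⨆ (Φ : Rn n → Fin n → Fin n → Fin n → ℝ) (_ : ContDiff ℝ ∞ Φ) (_ : HasCompactSupport Φ)
    (_ : tsupport Φ ⊆ Ω) (_ : ∀ x, ∑ i, ∑ j, ∑ k, Φ x i j k ^ 2 ≤ 1),
    ENNReal.ofReal (∫ x, ∑ i, ∑ j, ∑ k, G x i j * partialDeriv k (fun y => Φ y i j k) x)

section Frobenius

open scoped Matrix.Norms.Frobenius

/-- The distance of a matrix to a set of matrices, for the Euclidean (Frobenius) norm. -/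
noncomputable def matDist {n : ℕ} (A : Mat n) (K : Set (Mat n)) : ℝ :=
  Metric.infDist A K

end Frobenius

/-- The sharp interface energy
`inf { ∫_Ω dist²(∇u, K) dx + ε |∇²u|(Ω) : ∇u = M a.e. in ℝⁿ \ closure Ω }`. -/
noncomputable def sharpEnergy {n : ℕ} (Ω : Set (Rn n)) (K : Set (Mat n)) (M : Mat n) (ε : ℝ) :
    ℝ≥0∞ :=
  ⨅ (u : Rn n → Rn n) (G : Rn n → Mat n) (_ : HasWeakGradient u G)
    (_ : ∀ᵐ x, x ∉ closure Ω → G x = M),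
    (∫⁻ x in Ω, ENNReal.ofReal (matDist (G x) K ^ 2)) + ENNReal.ofReal ε * totalVariation G Ω

/-- `u`, with weak gradient `G`, solves the differential inclusion `∇u ∈ K` a.e. in `Ω`,
`∇u = M` a.e. in `ℝⁿ \ closure Ω`. -/
def IsInclusionSolution {n : ℕ} (Ω : Set (Rn n)) (K : Set (Mat n)) (M : Mat n)
    (u : Rn n → Rn n) (G : Rn n → Mat n) : Prop :=
  HasWeakGradient u G ∧ (∀ᵐ x, x ∈ Ω → G x ∈ K) ∧ (∀ᵐ x, x ∉ closure Ω → G x = M)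

/-- A smooth non-negative radially symmetric bump function, supported in `{|k| ≤ 2}` and equal to
one on `{|k| ≤ 1}`. -/
structure IsLPBump {n : ℕ} (χ : Rn n → ℝ) : Prop where
  smooth : ContDiff ℝ ∞ χ
  nonneg : ∀ k, 0 ≤ χ k
  radial : ∀ k k', ‖k‖ = ‖k'‖ → χ k = χ k'
  eq_one : ∀ k, ‖k‖ ≤ 1 → χ k = 1
  support_subset : Function.support χ ⊆ Metric.closedBall 0 2

/-- The Littlewood-Paley projector `P_N` with symbol `χ(k / N) - χ(2 k / N)`. The frequency `k`
refers to the Fourier transform with kernel `exp(i k·x)`; in the normalisation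
`exp(-2π i ξ·x)` of Mathlib, `k = -2πξ`, and the sign is irrelevant as `χ` is radial. -/
noncomputable def lpProj {n : ℕ} (χ : Rn n → ℝ) (N : ℝ) :
    𝓢'(Rn n, ℂ) →L[ℂ] 𝓢'(Rn n, ℂ) :=
  TemperedDistribution.fourierMultiplierCLM ℂ fun ξ : Rn n =>
    ((χ ((2 * Real.pi / N) • ξ) - χ ((2 * (2 * Real.pi / N)) • ξ) : ℝ) : ℂ)

/-- The `L¹` norm of a tempered distribution, `∞` if it is not given by an `L¹` function. -/
noncomputable def distL1Norm {n : ℕ} (T : 𝓢'(Rn n, ℂ)) : ℝ≥0∞ :=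
  ⨅ (f : Lp ℂ 1 (volume : Measure (Rn n))) (_ : (f : 𝓢'(Rn n, ℂ)) = T), ‖f‖ₑ

/-- The Besov norm `‖T‖_{B^σ_{1,1}} = ∑_{N ∈ 2^ℤ} N^σ ‖P_N T‖_{L¹}`. -/
noncomputable def besovNorm {n : ℕ} (χ : Rn n → ℝ) (σ : ℝ) (T : 𝓢'(Rn n, ℂ)) : ℝ≥0∞ :=
  ∑' j : ℤ, ENNReal.ofReal (((2 : ℝ) ^ j) ^ σ) * distL1Norm (lpProj χ ((2 : ℝ) ^ j) T)

/-- The tempered distribution `T` is given by the locally integrable function `f`. -/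
def IsGivenBy {n : ℕ} (T : 𝓢'(Rn n, ℂ)) (f : Rn n → ℝ) : Prop :=
  LocallyIntegrable f ∧
    ∀ φ : 𝓢(Rn n, ℂ), HasCompactSupport φ → T φ = ∫ x, φ x * (f x : ℂ)

/-- `v ∈ B^σ_{1,1}(ℝⁿ; ℝⁿ)`: every component of `v` is a tempered distribution of finite
Besov norm. -/
def MemBesov11 {n : ℕ} (χ : Rn n → ℝ) (σ : ℝ) (v : Rn n → Rn n) : Prop :=
  ∀ i, ∃ T : 𝓢'(Rn n, ℂ), IsGivenBy T (fun x => v x i) ∧ besovNorm χ σ T < ⊤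

/-! Suppose `s > 2μ` and fix `t` with `2μ < t < min s 1`. A solution with that much regularity would
yield competitors of energy `O(ε^t)` along `ε = 2^{-J}`, which is incompatible with the lower bound
`ε^{2μ} ≤ C E_ε` for large `J`.

The competitors come from low-frequency truncation. Each component `f` of `v` has bounded gradient,
hence a Lipschitz representative, and vanishes off the closure of `Ω`. Let `w` be its part at
frequencies up to `2^J`. The Lipschitz bound gives `|w - f| ≲ ε` and `|∇w| ≲ 1`. The Besov bound and
Bernstein's inequality give `‖∇w - ∇f‖_{L¹} ≲ ε^t` (a decaying geometric tail, as `t > 0`) and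
`‖∇²w‖_{L¹} ≲ ε^{t-1}` (a growing geometric sum, as `t < 1`). This is
`IsLPBump.exists_smooth_approx`.

Truncation destroys the boundary condition, so `w` is multiplied by a cutoff with transition at
distance about `ε` from the exterior. In that layer `|w| ≲ ε`, which compensates one derivative of
the cutoff: the product has gradient `O(1)` there, and its second derivatives gain only `O(1/ε)`.
The layer has measure `O(ε)` by `IsC11Domain.exists_measure_layer_le`, so the errors are `O(ε) ≤
ε^t` and `O(1) ≤ ε^{t-1}`; see `exists_cutoff_approx`.

Finally `∇u ∈ K`, so `dist²(·, K)` is at most the squared distance to `∇u`, and boundedness turns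
the square into a constant times the first power. Elastic and surface energy are then both `O(ε^t)`
(`sharpEnergy_le`). -/

open scoped LineDeriv FourierTransform Convolution

/-! ### Measure of the boundary layer of a `C^{1,1}` domain. -/

/-- If `k` translates of `A` along multiples of a vector are pairwise disjoint and contained in `B`,
then `k` times the measure of `A` is at most the measure of `B`. -/
lemma natCast_mul_measure_le_of_disjoint_translates {E : Type*} [NormedAddCommGroup E]
    [MeasurableSpace E] [BorelSpace E] (ν : Measure E) [ν.IsAddHaarMeasure]
    {A B : Set E} (hA : MeasurableSet A) (k : ℕ) (a : ℕ → E)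
    (hsub : ∀ i < k, ∀ x ∈ A, x + a i ∈ B)
    (hdisj : ∀ i < k, ∀ j < k, i ≠ j → ∀ x ∈ A, ∀ y ∈ A, x + a i ≠ y + a j) :
    (k : ℝ≥0∞) * ν A ≤ ν B := by
  have h1 : ∀ i, ν ((fun x => x + (-a i)) ⁻¹' A) = ν A := fun i =>
    measure_preimage_add_right ν _ A
  have h2 : ν (⋃ i ∈ Finset.range k, (fun x => x + (-a i)) ⁻¹' A) = k * ν A := by
    rw [measure_biUnion_finset]
    · simp [h1]
    · intro i hi j hj hij
      rw [Function.onFun, Set.disjoint_left]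
      intro x hx hy
      simp only [Finset.coe_range, Set.mem_Iio] at hi hj
      exact hdisj i hi j hj hij _ hx _ hy (by simp)
    · intro i _
      exact (measurable_add_const _) hA
  rw [← h2]
  refine measure_mono ?_
  intro x hx
  simp only [Finset.mem_range, Set.mem_iUnion] at hx
  obtain ⟨i, hi, hx⟩ := hx
  simpa using hsub i hi _ hx

/-- A slab of thickness `δ` below a graph over the orthogonal complement of `e` has measure
`O(δ)` in a ball. -/
lemma exists_measure_slab_le {n : ℕ} (e : Rn n) (he : ‖e‖ = 1) (γ : Rn n → ℝ) (hγ : Continuous γ)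
    (x₀ : Rn n) (r : ℝ) :
    ∃ C : ℝ, 0 ≤ C ∧ ∀ δ ∈ Set.Ioc (0 : ℝ) 1,
      volume ({x : Rn n | 0 < γ (x - ⟪e, x⟫_ℝ • e) - ⟪e, x⟫_ℝ ∧
        γ (x - ⟪e, x⟫_ℝ • e) - ⟪e, x⟫_ℝ ≤ δ} ∩ Metric.ball x₀ r) ≤ ENNReal.ofReal (C * δ) := by
  set V := (volume (Metric.ball x₀ (r + 1))).toReal with hV
  have hVfin : volume (Metric.ball x₀ (r + 1)) ≠ ⊤ := measure_ball_lt_top.ne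
  refine ⟨2 * V, by positivity, fun δ hδ => ?_⟩
  set F : Rn n → ℝ := fun x => γ (x - ⟪e, x⟫_ℝ • e) - ⟪e, x⟫_ℝ with hF
  have hFc : Continuous F := by fun_prop
  set A := {x : Rn n | 0 < F x ∧ F x ≤ δ} ∩ Metric.ball x₀ r with hA
  have hAm : MeasurableSet A :=
    ((measurableSet_lt measurable_const hFc.measurable).inter
      (measurableSet_le hFc.measurable measurable_const)).inter measurableSet_ball
  have hee : ⟪e, e⟫_ℝ = 1 := by rw [real_inner_self_eq_norm_sq, he]; norm_num
  -- `F` is the depth below the graph. Translation by `t e` lowers it by exactly `t`, so translates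
  -- of the slab by distinct multiples of `δ e` are disjoint.
  have hFt : ∀ x (t : ℝ), F (x + t • e) = F x - t := by
    intro x t
    have : ⟪e, x + t • e⟫_ℝ = ⟪e, x⟫_ℝ + t := by
      rw [inner_add_right, inner_smul_right, hee, mul_one]
    simp only [hF, this]
    have h2 : x + t • e - (⟪e, x⟫_ℝ + t) • e = x - ⟪e, x⟫_ℝ • e := by
      rw [add_smul]; abel
    rw [h2]; ring
  -- With this many translates every shift is shorter than one, so all of them lie in the ball of
  -- radius `r + 1`. Since `δ ≤ 1`, `k > 1 / (2δ)`, whence the constant `2 V`.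
  set k := ⌊1 / δ⌋₊ with hk
  have hk1 : (k : ℝ) ≤ 1 / δ := Nat.floor_le (by have := hδ.1; positivity)
  have hk2 : 1 / δ < k + 1 := Nat.lt_floor_add_one _
  have hk0 : 1 ≤ k := by
    rw [hk, Nat.one_le_floor_iff, le_div_iff₀ hδ.1, one_mul]; exact hδ.2
  have hmain := natCast_mul_measure_le_of_disjoint_translates (volume : Measure (Rn n)) hAm
    (B := Metric.ball x₀ (r + 1)) k (fun i => ((i : ℝ) * δ) • e) ?_ ?_
  · have hk0' : (1 : ℝ) ≤ k := by exact_mod_cast hk0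
    have hAfin : volume A ≠ ⊤ :=
      ((measure_mono inter_subset_right).trans_lt measure_ball_lt_top).ne
    have h3 : (k : ℝ) * (volume A).toReal ≤ V := by
      have := ENNReal.toReal_mono hVfin hmain
      simpa using this
    refine (ENNReal.le_ofReal_iff_toReal_le hAfin (by have := hδ.1; positivity)).2 ?_
    have h4 : 1 < 2 * k * δ := by
      have : 1 < (k + 1) * δ := by rwa [div_lt_iff₀ hδ.1] at hk2
      nlinarith [hδ.1]
    have h5 : (0 : ℝ) ≤ (volume A).toReal := ENNReal.toReal_nonneg
    calc (volume A).toReal ≤ (2 * k * δ) * (volume A).toReal := by nlinarith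
      _ = 2 * (k * (volume A).toReal) * δ := by ring
      _ ≤ 2 * V * δ := by have := hδ.1; gcongr
  · intro i hi x hx
    have h1 : ((i : ℝ) * δ) ≤ 1 := by
      have : (i : ℝ) ≤ k := by exact_mod_cast hi.le
      calc (i : ℝ) * δ ≤ (1 / δ) * δ := by have := hδ.1; gcongr; linarith
        _ = 1 := by have := hδ.1; field_simp
    have h0 : 0 ≤ (i : ℝ) * δ := by have := hδ.1; positivity
    have := hx.2
    rw [Metric.mem_ball] at this ⊢
    calc dist (x + ((i : ℝ) * δ) • e) x₀ ≤ dist (x + ((i : ℝ) * δ) • e) x + dist x x₀ :=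
          dist_triangle _ _ _
      _ < 1 + r := by
          have : dist (x + ((i : ℝ) * δ) • e) x = (i : ℝ) * δ := by
            rw [dist_eq_norm, add_sub_cancel_left, norm_smul, he, mul_one, Real.norm_of_nonneg h0]
          linarith
      _ = r + 1 := by ring
  · intro i _ j _ hij x hx y hy hxy
    have := congrArg F hxy
    rw [hFt, hFt] at this
    have hx1 := hx.1.1; have hx2 := hx.1.2; have hy1 := hy.1.1; have hy2 := hy.1.2
    have h3 : |((i : ℝ) - j) * δ| < δ := by
      rw [abs_lt]; constructor <;> nlinarith
    rw [abs_mul, abs_of_pos hδ.1] at h3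
    have h4 : |(i : ℝ) - j| < 1 := by
      have := hδ.1
      by_contra h; push Not at h; nlinarith
    have h5 : |(i : ℤ) - j| < 1 := by exact_mod_cast h4
    rw [Int.abs_lt_one_iff] at h5
    exact hij (by omega)

/-- A point of `Ω` within `δ` of the complement is within `δ` of the frontier. -/
lemma exists_mem_frontier_dist_lt {E : Type*} [NormedAddCommGroup E] [NormedSpace ℝ E]
    {Ω : Set E} {x y : E} (hx : x ∈ Ω) (hy : y ∉ Ω) {δ : ℝ} (hxy : dist x y < δ) :
    ∃ z ∈ frontier Ω, dist x z < δ := by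
  have hne : (segment ℝ x y ∩ frontier Ω).Nonempty := by
    -- If the segment missed the frontier, the interior and the exterior of `Ω` would disconnect it.
    by_contra hemp
    rw [Set.not_nonempty_iff_eq_empty] at hemp
    have hnf : ∀ z ∈ segment ℝ x y, z ∈ closure Ω → z ∈ interior Ω := fun z hz hzc => by
      by_contra h
      exact (Set.ext_iff.1 hemp z).1 ⟨hz, hzc, h⟩
    obtain ⟨z, -, hz1, hz2⟩ := (convex_segment x y).isPreconnected (interior Ω) (closure Ω)ᶜ
      isOpen_interior isClosed_closure.isOpen_compl
      (fun z hz => (em (z ∈ closure Ω)).imp (hnf z hz) id)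
      ⟨x, left_mem_segment ℝ x y, hnf x (left_mem_segment ℝ x y) (subset_closure hx)⟩
      ⟨y, right_mem_segment ℝ x y, fun h =>
        hy (interior_subset (hnf y (right_mem_segment ℝ x y) h))⟩
    exact hz2 (interior_subset_closure hz1)
  obtain ⟨z, hz, hzf⟩ := hne
  refine ⟨z, hzf, lt_of_le_of_lt ?_ hxy⟩
  have := dist_add_dist_of_mem_segment hz
  linarith [dist_nonneg (x := z) (y := y)]

/-- The part of a bounded `C^{1,1}` domain within distance `δ` of its complement has measure
`O(δ)`. -/
lemma IsC11Domain.exists_measure_layer_le {n : ℕ} {Ω : Set (Rn n)} (hΩ : IsC11Domain Ω)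
    (hΩb : Bornology.IsBounded Ω) :
    ∃ C : ℝ, 0 ≤ C ∧ ∀ δ ∈ Set.Ioc (0 : ℝ) 1,
      volume (Ω ∩ Metric.thickening δ Ωᶜ) ≤ ENNReal.ofReal (C * δ) := by
  have hcpt : IsCompact (frontier Ω) :=
    Metric.isCompact_of_isClosed_isBounded isClosed_frontier
      (hΩb.closure.subset frontier_subset_closure)
  have key : ∀ x₀ ∈ frontier Ω, ∃ ρ > 0, ∃ C : ℝ, 0 ≤ C ∧ ∀ δ ∈ Set.Ioc (0 : ℝ) ρ,
      volume (Ω ∩ {x | ∃ z ∈ frontier Ω ∩ Metric.ball x₀ ρ, dist x z < δ}) ≤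
        ENNReal.ofReal (C * δ) := by
    intro x₀ hx₀
    obtain ⟨e, r, γ, L, he, hr, hγ, -, hloc⟩ := hΩ.2 x₀ hx₀
    set P : Rn n → Rn n := fun x => x - ⟪e, x⟫_ℝ • e with hP
    have hPlip : ∀ x y, ‖P x - P y‖ ≤ 2 * ‖x - y‖ := by
      intro x y
      have : P x - P y = (x - y) - ⟪e, x - y⟫_ℝ • e := by
        simp only [hP, inner_sub_right, sub_smul]; abel
      rw [this]
      have h1 := norm_sub_le (x - y) (⟪e, x - y⟫_ℝ • e)
      have h2 : ‖⟪e, x - y⟫_ℝ • e‖ ≤ ‖x - y‖ := by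
        rw [norm_smul, he, mul_one]
        simpa [he] using norm_inner_le_norm (𝕜 := ℝ) e (x - y)
      linarith
    set R := 2 * r with hR
    have hPball : ∀ x ∈ Metric.ball x₀ r, P x ∈ Metric.closedBall (P x₀) R := by
      intro x hx
      rw [Metric.mem_ball, dist_eq_norm] at hx
      rw [Metric.mem_closedBall, dist_eq_norm]
      linarith [hPlip x x₀]
    obtain ⟨Λ, hΛ⟩ := (isCompact_closedBall (P x₀) R).exists_bound_of_continuousOn
      (hγ.continuous_fderiv (by norm_num)).continuousOn
    have hΛ0 : 0 ≤ Λ := (norm_nonneg _).trans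
      (hΛ (P x₀) (Metric.mem_closedBall_self (by positivity)))
    have hγlip : ∀ x ∈ Metric.ball x₀ r, ∀ y ∈ Metric.ball x₀ r,
        |γ (P x) - γ (P y)| ≤ Λ * (2 * ‖x - y‖) := by
      intro x hx y hy
      have := (convex_closedBall (P x₀) R).norm_image_sub_le_of_norm_fderiv_le
        (fun z _ => (hγ.differentiable (by norm_num)).differentiableAt) hΛ
        (hPball y hy) (hPball x hx)
      rw [Real.norm_eq_abs] at this
      exact this.trans (by gcongr; exact hPlip x y)
    -- `2Λ` is the Lipschitz constant of `γ ∘ P` near `x₀`, and `1` that of the coordinate along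
    -- `e`. A point of `Ω` within `δ` of the frontier is thus at depth at most `c δ` below the
    -- graph.
    set c := 2 * Λ + 1 with hc
    have hc1 : 1 ≤ c := by linarith
    obtain ⟨C, hC0, hC⟩ := exists_measure_slab_le e he γ hγ.continuous x₀ r
    -- The bound `r / 2` keeps the frontier point and its `δ`-neighbour inside the chart; `1 / c`
    -- keeps the slab thickness `c δ` below one.
    refine ⟨min (r / 2) (1 / c), by positivity, C * c, by positivity, fun δ hδ => ?_⟩
    have hδ0 := hδ.1
    have hδr : δ ≤ r / 2 := hδ.2.trans (min_le_left _ _)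
    have hδc : c * δ ≤ 1 := by
      have := hδ.2.trans (min_le_right _ _)
      rw [le_div_iff₀ (by positivity)] at this
      linarith
    refine (measure_mono ?_).trans ((hC (c * δ) ⟨by positivity, hδc⟩).trans_eq (by ring_nf))
    rintro x ⟨hxΩ, z, ⟨hzf, hzb⟩, hxz⟩
    have hzb' : z ∈ Metric.ball x₀ r :=
      Metric.ball_subset_ball ((min_le_left _ _).trans (by linarith)) hzb
    have hxb : x ∈ Metric.ball x₀ r := by
      rw [Metric.mem_ball] at hzb ⊢
      have := dist_triangle x z x₀
      have h2 := min_le_left (r / 2) (1 / c)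
      linarith
    have hzΩ : z ∉ Ω := by
      intro h
      rw [frontier, mem_sdiff, hΩ.1.interior_eq] at hzf
      exact hzf.2 h
    have hx1 : ⟪e, x⟫_ℝ < γ (P x) := by
      have : x ∈ Ω ∩ Metric.ball x₀ r := ⟨hxΩ, hxb⟩
      rw [hloc] at this
      exact this.1
    have hz1 : γ (P z) ≤ ⟪e, z⟫_ℝ := by
      by_contra h
      push Not at h
      have : z ∈ {x | ⟪e, x⟫_ℝ < γ (x - ⟪e, x⟫_ℝ • e)} ∩ Metric.ball x₀ r := ⟨h, hzb'⟩
      rw [← hloc] at this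
      exact hzΩ this.1
    refine ⟨⟨by simpa [hP] using hx1, ?_⟩, hxb⟩
    have h3 := (abs_le.1 (hγlip x hxb z hzb')).2
    have h4 : ⟪e, z⟫_ℝ - ⟪e, x⟫_ℝ ≤ ‖x - z‖ := by
      rw [← inner_sub_right, norm_sub_rev]
      have := real_inner_le_norm e (z - x)
      rwa [he, one_mul] at this
    have h5 : ‖x - z‖ < δ := by rwa [← dist_eq_norm]
    change γ (P x) - ⟪e, x⟫_ℝ ≤ c * δ
    have : c * ‖x - z‖ ≤ c * δ := by gcongr
    calc γ (P x) - ⟪e, x⟫_ℝ ≤ c * ‖x - z‖ := by rw [hc]; linarith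
      _ ≤ c * δ := this
  choose! ρ hρ Cf hCf hbound using key
  obtain ⟨t, ht, hcover⟩ := hcpt.elim_nhds_subcover (fun x => Metric.ball x (ρ x))
    (fun x hx => Metric.ball_mem_nhds x (hρ x hx))
  obtain ⟨ρ₀, hρ₀, hρ₀t⟩ : ∃ ρ₀ > 0, ∀ x ∈ t, ρ₀ ≤ ρ x := by
    rcases t.eq_empty_or_nonempty with rfl | hne
    · exact ⟨1, one_pos, by simp⟩
    · obtain ⟨x, hx, hmin⟩ := t.exists_min_image ρ hne
      exact ⟨ρ x, hρ x (ht x hx), hmin⟩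
  set V := (volume Ω).toReal with hV
  have hVfin : volume Ω ≠ ⊤ := hΩb.measure_lt_top.ne
  have hS0 : 0 ≤ ∑ x ∈ t, Cf x := Finset.sum_nonneg fun x hx => hCf x (ht x hx)
  -- The term `V / ρ₀` covers `δ > ρ₀`, where the volume of `Ω` itself is an adequate bound.
  refine ⟨∑ x ∈ t, Cf x + V / ρ₀, by positivity, fun δ hδ => ?_⟩
  have hδ0 := hδ.1
  rcases le_or_gt δ ρ₀ with h | h
  · have hsub : Ω ∩ Metric.thickening δ Ωᶜ ⊆
        ⋃ x ∈ t, Ω ∩ {y | ∃ z ∈ frontier Ω ∩ Metric.ball x (ρ x), dist y z < δ} := by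
      rintro y ⟨hy, hyt⟩
      obtain ⟨y', hy', hyy'⟩ := Metric.mem_thickening_iff.1 hyt
      obtain ⟨z, hz, hyz⟩ := exists_mem_frontier_dist_lt hy hy' hyy'
      obtain ⟨x, hxt, hzx⟩ := Set.mem_iUnion₂.1 (hcover hz)
      exact Set.mem_iUnion₂.2 ⟨x, hxt, hy, z, ⟨hz, hzx⟩, hyz⟩
    calc volume (Ω ∩ Metric.thickening δ Ωᶜ)
        ≤ ∑ x ∈ t, volume (Ω ∩ {y | ∃ z ∈ frontier Ω ∩ Metric.ball x (ρ x), dist y z < δ}) :=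
          (measure_mono hsub).trans (measure_biUnion_finset_le _ _)
      _ ≤ ∑ x ∈ t, ENNReal.ofReal (Cf x * δ) :=
          Finset.sum_le_sum fun x hx => hbound x (ht x hx) δ ⟨hδ0, h.trans (hρ₀t x hx)⟩
      _ = ENNReal.ofReal ((∑ x ∈ t, Cf x) * δ) := by
          rw [← ENNReal.ofReal_sum_of_nonneg, Finset.sum_mul]
          intro x hx
          have := hCf x (ht x hx)
          positivity
      _ ≤ _ := by
          apply ENNReal.ofReal_le_ofReal
          have : 0 ≤ V / ρ₀ := by positivity
          gcongr
          linarith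
  · refine (measure_mono inter_subset_left).trans ?_
    rw [← ENNReal.ofReal_toReal hVfin]
    apply ENNReal.ofReal_le_ofReal
    rw [← hV, add_mul]
    have h1 : V ≤ V / ρ₀ * δ := by
      rw [div_mul_eq_mul_div, le_div_iff₀ hρ₀]
      have : 0 ≤ V := ENNReal.toReal_nonneg
      gcongr
    have : 0 ≤ (∑ x ∈ t, Cf x) * δ := by positivity
    linarith

/-! ### Calculus of convolution with Schwartz kernels. -/

/-- The convolution of a function with a Schwartz kernel. -/
noncomputable def schwartzConv {n : ℕ} (f : Rn n → ℂ) (ρ : 𝓢(Rn n, ℂ)) (x : Rn n) : ℂ :=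
  ∫ t, f t * ρ (x - t)

section SchwartzConv

variable {n : ℕ} {f g : Rn n → ℂ}

lemma schwartzConv_eq_convolution (f : Rn n → ℂ) (ρ : 𝓢(Rn n, ℂ)) :
    schwartzConv f ρ = f ⋆[ContinuousLinearMap.mul ℂ ℂ, volume] ρ := rfl

lemma integrable_mul_schwartz_sub (hf : Integrable f) (ρ : 𝓢(Rn n, ℂ)) (x : Rn n) :
    Integrable fun t => f t * ρ (x - t) :=
  hf.mul_bdd (c := SchwartzMap.seminorm ℝ 0 0 ρ)
    (ρ.continuous.comp (continuous_const.sub continuous_id)).aestronglyMeasurable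
    (Filter.Eventually.of_forall fun t => SchwartzMap.norm_le_seminorm ℝ ρ (x - t))

lemma exists_norm_fderiv_schwartz_le (ρ : 𝓢(Rn n, ℂ)) : ∃ B, ∀ x, ‖fderiv ℝ ρ x‖ ≤ B :=
  ⟨_, fun x => by
    simpa using SchwartzMap.norm_le_seminorm ℝ (SchwartzMap.fderivCLM ℝ (Rn n) ℂ ρ) x⟩

lemma hasFDerivAt_schwartzConv (hf : Integrable f) (ρ : 𝓢(Rn n, ℂ)) (x : Rn n) :
    HasFDerivAt (schwartzConv f ρ) (∫ t, f t • fderiv ℝ ρ (x - t)) x := by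
  obtain ⟨B, hB⟩ := exists_norm_fderiv_schwartz_le ρ
  have hcont : Continuous (fderiv ℝ ρ) := (ρ.smooth 1).continuous_fderiv (by norm_num)
  refine hasFDerivAt_integral_of_dominated_of_fderiv_le (s := Set.univ)
    (F := fun x t => f t * ρ (x - t)) (F' := fun x t => f t • fderiv ℝ ρ (x - t))
    (bound := fun t => ‖f t‖ * B)
    Filter.univ_mem ?_ (integrable_mul_schwartz_sub hf ρ x) ?_ ?_ (hf.norm.mul_const B) ?_
  · exact Filter.Eventually.of_forall fun y =>
      (integrable_mul_schwartz_sub hf ρ y).aestronglyMeasurable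
  · exact hf.aestronglyMeasurable.smul
      (hcont.comp (continuous_const.sub continuous_id)).aestronglyMeasurable
  · refine Filter.Eventually.of_forall fun t y _ => ?_
    rw [norm_smul]
    gcongr
    exact hB _
  · refine Filter.Eventually.of_forall fun t y _ => ?_
    have h1 : HasFDerivAt (fun y => ρ (y - t)) (fderiv ℝ ρ (y - t)) y := by
      have h := (ρ.differentiableAt (x := y - t)).hasFDerivAt.comp y
        ((hasFDerivAt_id y).sub_const t)
      rwa [ContinuousLinearMap.comp_id] at h
    exact h1.const_mul (f t)

/-- Derivatives fall on the kernel, which stays Schwartz, so the formula iterates; smoothness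
follows by induction over all kernels at once. -/
lemma fderiv_schwartzConv_apply (hf : Integrable f) (ρ : 𝓢(Rn n, ℂ)) (x m : Rn n) :
    fderiv ℝ (schwartzConv f ρ) x m = schwartzConv f (∂_{m} ρ) x := by
  obtain ⟨B, hB⟩ := exists_norm_fderiv_schwartz_le ρ
  have hcont : Continuous (fderiv ℝ ρ) := (ρ.smooth 1).continuous_fderiv (by norm_num)
  have hint : Integrable fun t => f t • fderiv ℝ ρ (x - t) := by
    refine (hf.norm.mul_const B).mono' (hf.aestronglyMeasurable.smul
      (hcont.comp (continuous_const.sub continuous_id)).aestronglyMeasurable) ?_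
    refine Filter.Eventually.of_forall fun t => ?_
    rw [norm_smul]
    gcongr
    exact hB _
  rw [(hasFDerivAt_schwartzConv hf ρ x).fderiv, ContinuousLinearMap.integral_apply hint]
  simp [schwartzConv, SchwartzMap.lineDerivOp_apply_eq_fderiv]

lemma contDiff_schwartzConv (hf : Integrable f) (k : ℕ) (ρ : 𝓢(Rn n, ℂ)) :
    ContDiff ℝ k (schwartzConv f ρ) := by
  induction k generalizing ρ with
  | zero =>
    rw [Nat.cast_zero, contDiff_zero, continuous_iff_continuousAt]
    exact fun x => (hasFDerivAt_schwartzConv hf ρ x).continuousAt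
  | succ k ih =>
    rw [Nat.cast_succ, contDiff_succ_iff_fderiv_apply]
    refine ⟨fun x => (hasFDerivAt_schwartzConv hf ρ x).differentiableAt, by simp, fun m => ?_⟩
    simp_rw [fderiv_schwartzConv_apply hf]
    exact ih _

lemma integrable_schwartzConv (hf : Integrable f) (ρ : 𝓢(Rn n, ℂ)) :
    Integrable (schwartzConv f ρ) :=
  hf.integrable_convolution (ContinuousLinearMap.mul ℂ ℂ) ρ.integrable

/-- Young's inequality for `L¹ * L¹`; the next lemma is its `L^∞ * L¹` counterpart. -/
lemma integral_norm_schwartzConv_le (hf : Integrable f) (ρ : 𝓢(Rn n, ℂ)) :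
    ∫ x, ‖schwartzConv f ρ x‖ ≤ (∫ x, ‖f x‖) * ∫ x, ‖ρ x‖ := by
  have h := integral_convolution (ContinuousLinearMap.mul ℝ ℝ) hf.norm
    (ρ.integrable (μ := volume)).norm
  rw [ContinuousLinearMap.mul_apply'] at h
  rw [← h]
  refine integral_mono (integrable_schwartzConv hf ρ).norm
    (hf.norm.integrable_convolution (ContinuousLinearMap.mul ℝ ℝ) ρ.integrable.norm) fun x => ?_
  refine (norm_integral_le_integral_norm _).trans_eq ?_
  simp [convolution]

lemma norm_schwartzConv_le {B : ℝ} (hB : ∀ᵐ t, ‖f t‖ ≤ B) (ρ : 𝓢(Rn n, ℂ)) (x : Rn n) :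
    ‖schwartzConv f ρ x‖ ≤ B * ∫ t, ‖ρ t‖ := by
  rw [← integral_sub_left_eq_self (fun t => ‖ρ t‖) volume x, ← integral_const_mul]
  refine norm_integral_le_of_norm_le ((ρ.integrable.norm.comp_sub_left x).const_mul B) ?_
  filter_upwards [hB] with t ht
  rw [norm_mul]
  gcongr

lemma schwartzConv_sub_right (hf : Integrable f) (ρ σ : 𝓢(Rn n, ℂ)) (x : Rn n) :
    schwartzConv f (ρ - σ) x = schwartzConv f ρ x - schwartzConv f σ x := by
  simp only [schwartzConv]
  rw [← integral_sub (integrable_mul_schwartz_sub hf ρ x) (integrable_mul_schwartz_sub hf σ x)]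
  simp [mul_sub]

lemma schwartzConv_smul_right (c : ℂ) (ρ : 𝓢(Rn n, ℂ)) (x : Rn n) :
    schwartzConv f (c • ρ) x = c * schwartzConv f ρ x := by
  simp only [schwartzConv]
  rw [← integral_const_mul]
  congr 1 with t
  simp
  ring

/-- Associativity of convolution, the product of the kernels being determined by its Fourier
transform. -/
lemma schwartzConv_schwartzConv (hf : Integrable f) {ρ σ κ : 𝓢(Rn n, ℂ)}
    (h : ∀ ξ, 𝓕 κ ξ = 𝓕 ρ ξ * 𝓕 σ ξ) :
    schwartzConv (schwartzConv f ρ) σ = schwartzConv f κ := by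
  -- The Fourier transform is injective on Schwartz functions, so `κ` is the convolution of `ρ` and
  -- `σ`. What remains is Fubini.
  have hκ : κ = SchwartzMap.convolution (ContinuousLinearMap.mul ℂ ℂ) ρ σ := by
    have h1 : 𝓕 κ = 𝓕 (SchwartzMap.convolution (ContinuousLinearMap.mul ℂ ℂ) ρ σ) := by
      ext ξ
      rw [h, SchwartzMap.fourier_convolution, SchwartzMap.pairing_apply_apply]
      rfl
    rw [← FourierTransform.fourierInv_fourier_eq (F := 𝓢(Rn n, ℂ)) κ, h1,
      FourierTransform.fourierInv_fourier_eq]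
  have hκ' : (κ : Rn n → ℂ) = ρ ⋆[ContinuousLinearMap.mul ℂ ℂ, volume] σ := by
    ext x
    rw [hκ, SchwartzMap.convolution_apply]
  simp only [schwartzConv_eq_convolution]
  rw [hκ']
  funext x
  have hnn : (fun x => ‖f x‖) = fun x => ‖f x‖ := rfl
  refine convolution_assoc (ContinuousLinearMap.mul ℂ ℂ) (ContinuousLinearMap.mul ℂ ℂ)
    (ContinuousLinearMap.mul ℂ ℂ) (ContinuousLinearMap.mul ℂ ℂ)
    (fun a b c => by simp [mul_assoc]) hf.aestronglyMeasurable ρ.continuous.aestronglyMeasurable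
    σ.continuous.aestronglyMeasurable
    (Filter.Eventually.of_forall fun y => integrable_mul_schwartz_sub hf ρ y)
    (Filter.Eventually.of_forall fun y => ?_) ?_
  · have := (integrable_mul_schwartz_sub ρ.integrable σ y).norm
    simpa [ConvolutionExistsAt, norm_mul] using this
  · have hb : ∀ y, ‖((fun x => ‖ρ x‖) ⋆[ContinuousLinearMap.mul ℝ ℝ, volume] fun x => ‖σ x‖) y‖ ≤
        (∫ t, ‖ρ t‖) * SchwartzMap.seminorm ℝ 0 0 σ := by
      intro y
      rw [← integral_mul_const]
      refine norm_integral_le_of_norm_le (ρ.integrable.norm.mul_const _) ?_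
      refine Filter.Eventually.of_forall fun t => ?_
      simp only [ContinuousLinearMap.mul_apply', norm_mul, norm_norm]
      gcongr
      exact SchwartzMap.norm_le_seminorm ℝ σ _
    have hmeas : AEStronglyMeasurable
        ((fun x => ‖ρ x‖) ⋆[ContinuousLinearMap.mul ℝ ℝ, volume] fun x => ‖σ x‖) volume :=
      (ρ.integrable.norm.integrable_convolution (ContinuousLinearMap.mul ℝ ℝ)
        σ.integrable.norm).aestronglyMeasurable
    refine hf.norm.mul_bdd (c := (∫ t, ‖ρ t‖) * SchwartzMap.seminorm ℝ 0 0 σ) ?_ ?_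
    · exact hmeas.comp_quasiMeasurePreserving
        (quasiMeasurePreserving_sub_left_of_right_invariant volume x)
    · exact Filter.Eventually.of_forall fun t => hb _

/-- If `g` is the weak derivative of `f` in direction `m`, tested with all smooth functions, then
differentiating the kernel amounts to replacing `f` by `g`. -/
lemma schwartzConv_lineDeriv_of_weakDeriv {m : Rn n}
    (h : ∀ φ : Rn n → ℂ, ContDiff ℝ ∞ φ → ∫ t, f t * fderiv ℝ φ t m = -∫ t, g t * φ t)
    (ρ : 𝓢(Rn n, ℂ)) : schwartzConv f (∂_{m} ρ) = schwartzConv g ρ := by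
  funext x
  -- The reflected translate of the kernel serves as test function. It need not have compact
  -- support, hence the form of the hypothesis.
  have h1 := h (fun t => ρ (x - t)) ((ρ.smooth ⊤).comp (contDiff_const.sub contDiff_id))
  have h2 : ∀ t, fderiv ℝ (fun t => ρ (x - t)) t m = -∂_{m} ρ (x - t) := by
    intro t
    have : HasFDerivAt (fun t => ρ (x - t))
        ((fderiv ℝ ρ (x - t)).comp (-ContinuousLinearMap.id ℝ (Rn n))) t :=
      (ρ.differentiableAt (x := x - t)).hasFDerivAt.comp t
        ((hasFDerivAt_id t).const_sub x)
    rw [this.fderiv, SchwartzMap.lineDerivOp_apply_eq_fderiv]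
    simp
  simp only [h2, mul_neg, integral_neg, neg_inj] at h1
  exact h1

end SchwartzConv

/-! ### Dilated kernels and mollification at scale `1 / N`. -/

section Dilation

variable {n : ℕ}

/-- The `L¹`-normalised dilation `x ↦ Nⁿ ρ(N x)` of a Schwartz function, for `N ≠ 0`. -/
noncomputable def schwartzDil (N : ℝ) (hN : N ≠ 0) (ρ : 𝓢(Rn n, ℂ)) : 𝓢(Rn n, ℂ) :=
  ((N : ℂ) ^ n) • SchwartzMap.compCLMOfContinuousLinearEquiv ℂ
    (ContinuousLinearEquiv.smulLeft (Units.mk0 N hN)) ρ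

lemma schwartzDil_apply (N : ℝ) (hN : N ≠ 0) (ρ : 𝓢(Rn n, ℂ)) (x : Rn n) :
    schwartzDil N hN ρ x = (N : ℂ) ^ n * ρ (N • x) := by
  simp [schwartzDil]

lemma integral_comp_smul_Rn {F : Type*} [NormedAddCommGroup F] [NormedSpace ℝ F] {N : ℝ}
    (hN : 0 < N) (h : Rn n → F) : ∫ x, N ^ n • h (N • x) = ∫ x, h x := by
  rw [integral_smul, Measure.integral_comp_smul_of_nonneg volume h N (hR := hN.le)]
  simp [smul_smul, hN.ne']

lemma integral_norm_schwartzDil {N : ℝ} (hN : 0 < N) (ρ : 𝓢(Rn n, ℂ)) :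
    ∫ x, ‖schwartzDil N hN.ne' ρ x‖ = ∫ x, ‖ρ x‖ := by
  rw [← integral_comp_smul_Rn hN (fun x => ‖ρ x‖)]
  congr 1 with x
  simp [schwartzDil_apply, abs_of_pos hN]

/-- Dilation preserves the `L¹` norm, so each derivative costs exactly a factor `N` in `L¹`. This is
the source of Bernstein's inequality below. -/
lemma lineDeriv_schwartzDil (N : ℝ) (hN : N ≠ 0) (m : Rn n) (ρ : 𝓢(Rn n, ℂ)) :
    ∂_{m} (schwartzDil N hN ρ) = (N : ℂ) • schwartzDil N hN (∂_{m} ρ) := by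
  ext x
  have h1 : HasFDerivAt (fun x => (N : ℂ) ^ n * ρ (N • x))
      ((N : ℂ) ^ n • (fderiv ℝ ρ (N • x)).comp (N • ContinuousLinearMap.id ℝ (Rn n))) x := by
    refine HasFDerivAt.const_mul ?_ _
    exact (ρ.differentiableAt (x := N • x)).hasFDerivAt.comp x ((hasFDerivAt_id x).const_smul N)
  have h2 : (schwartzDil N hN ρ : Rn n → ℂ) = fun x => (N : ℂ) ^ n * ρ (N • x) :=
    funext fun x => schwartzDil_apply N hN ρ x
  rw [SchwartzMap.lineDerivOp_apply_eq_fderiv, h2, h1.fderiv]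
  simp [schwartzDil_apply, SchwartzMap.lineDerivOp_apply_eq_fderiv]
  ring

lemma fourier_schwartzDil {N : ℝ} (hN : 0 < N) (ρ : 𝓢(Rn n, ℂ)) (ξ : Rn n) :
    𝓕 (schwartzDil N hN.ne' ρ) ξ = 𝓕 ρ (N⁻¹ • ξ) := by
  rw [SchwartzMap.fourier_coe, SchwartzMap.fourier_coe, Real.fourier_eq, Real.fourier_eq,
    ← integral_comp_smul_Rn hN (fun x => Real.fourierChar (-⟪x, N⁻¹ • ξ⟫_ℝ) • ρ x)]
  congr 1 with x
  rw [schwartzDil_apply]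
  have : ⟪N • x, N⁻¹ • ξ⟫_ℝ = ⟪x, ξ⟫_ℝ := by
    rw [inner_smul_left, inner_smul_right]
    simp [hN.ne']
  rw [this]
  simp only [Circle.smul_def, smul_eq_mul, Complex.real_smul]
  push_cast
  ring

/-- Mollifying a Lipschitz function at scale `1 / N` changes it by `O(1 / N)`. -/
lemma norm_schwartzConv_dil_sub_le {N : ℝ} (hN : 0 < N) {ρ : 𝓢(Rn n, ℂ)} (hρ : ∫ x, ρ x = 1)
    {f : Rn n → ℂ} {L : ℝ≥0} (hf : LipschitzWith L f) (hfi : Integrable f) (x : Rn n) :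
    ‖schwartzConv f (schwartzDil N hN.ne' ρ) x - f x‖ ≤ L * (∫ y, ‖y‖ * ‖ρ y‖) * N⁻¹ := by
  have h1 : ∫ t, schwartzDil N hN.ne' ρ (x - t) = 1 := by
    rw [integral_sub_left_eq_self (fun t => schwartzDil N hN.ne' ρ t) volume x, ← hρ,
      ← integral_comp_smul_Rn hN (fun x => ρ x)]
    congr 1 with y
    simp [schwartzDil_apply]
  have hint : Integrable fun t => schwartzDil N hN.ne' ρ (x - t) :=
    (schwartzDil N hN.ne' ρ).integrable.comp_sub_left x
  -- The kernel has integral one, so `f x` can be moved under the integral; the Lipschitz bound then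
  -- leaves the first moment of the kernel, which scales like `1 / N`.
  have h2 : schwartzConv f (schwartzDil N hN.ne' ρ) x - f x =
      ∫ t, (f t - f x) * schwartzDil N hN.ne' ρ (x - t) := by
    rw [schwartzConv]
    simp_rw [sub_mul]
    rw [integral_sub (integrable_mul_schwartz_sub hfi _ x) (hint.const_mul _),
      integral_const_mul, h1, mul_one]
  have hmom : Integrable fun y => ‖y‖ * ‖ρ y‖ := by
    simpa using ρ.integrable_pow_mul volume 1
  have h3 : ∫ t, ‖x - t‖ * ‖schwartzDil N hN.ne' ρ (x - t)‖ = (∫ y, ‖y‖ * ‖ρ y‖) * N⁻¹ := by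
    rw [integral_sub_left_eq_self (fun t => ‖t‖ * ‖schwartzDil N hN.ne' ρ t‖) volume x,
      ← integral_comp_smul_Rn hN (fun y => ‖y‖ * ‖ρ y‖), ← integral_mul_const]
    congr 1 with y
    simp [schwartzDil_apply, norm_smul, abs_of_pos hN]
    field_simp
  rw [h2, mul_assoc, ← h3, ← integral_const_mul]
  refine norm_integral_le_of_norm_le ?_ (Filter.Eventually.of_forall fun t => ?_)
  · refine Integrable.const_mul ?_ _
    have : Integrable fun y => ‖y‖ * ‖schwartzDil N hN.ne' ρ y‖ := by
      simpa using (schwartzDil N hN.ne' ρ).integrable_pow_mul volume 1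
    exact this.comp_sub_left x
  · rw [norm_mul, ← mul_assoc]
    gcongr
    rw [norm_sub_rev x t]
    exact hf.norm_sub_le t x

end Dilation

/-! ### Truncation of Schwartz functions; extending `IsGivenBy` to all test functions. -/

section Cutoff

open Filter Topology

variable {n : ℕ} {χ : Rn n → ℝ}

lemma IsLPBump.hasCompactSupport_comp_smul (hχ : IsLPBump χ) {c : ℝ} (hc : 0 < c) :
    HasCompactSupport fun x => (χ (c • x) : ℂ) := by
  refine HasCompactSupport.of_support_subset_isCompact
    (isCompact_closedBall (0 : Rn n) (2 / c)) fun x hx => ?_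
  have h1 : c • x ∈ Metric.closedBall (0 : Rn n) 2 := hχ.support_subset fun h => hx (by
    simp only [h, Complex.ofReal_zero])
  rw [mem_closedBall_zero_iff, norm_smul, Real.norm_of_nonneg hc.le] at h1
  rw [mem_closedBall_zero_iff, le_div_iff₀ hc]
  linarith

lemma IsLPBump.contDiff_comp_smul (hχ : IsLPBump χ) (c : ℝ) :
    ContDiff ℝ ∞ fun x => (χ (c • x) : ℂ) :=
  Complex.ofRealCLM.contDiff.comp (hχ.smooth.comp (contDiff_id.const_smul c))

/-- The Schwartz function `χ(c x)`. -/
noncomputable def IsLPBump.schwartz (hχ : IsLPBump χ) {c : ℝ} (hc : 0 < c) : 𝓢(Rn n, ℂ) :=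
  (hχ.hasCompactSupport_comp_smul hc).toSchwartzMap (hχ.contDiff_comp_smul c)

@[simp]
lemma IsLPBump.schwartz_apply (hχ : IsLPBump χ) {c : ℝ} (hc : 0 < c) (x : Rn n) :
    hχ.schwartz hc x = χ (c • x) := rfl

/-- The truncation `χ(c x) φ(x)` of a Schwartz function. -/
noncomputable def IsLPBump.truncate (hχ : IsLPBump χ) {c : ℝ} (hc : 0 < c)
    (φ : 𝓢(Rn n, ℂ)) : 𝓢(Rn n, ℂ) :=
  ((hχ.hasCompactSupport_comp_smul hc).mul_right (f' := φ)).toSchwartzMap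
    ((hχ.contDiff_comp_smul c).mul (φ.smooth ⊤))

@[simp]
lemma IsLPBump.truncate_apply (hχ : IsLPBump χ) {c : ℝ} (hc : 0 < c) (φ : 𝓢(Rn n, ℂ))
    (x : Rn n) : hχ.truncate hc φ x = χ (c • x) * φ x := rfl

lemma IsLPBump.hasCompactSupport_truncate (hχ : IsLPBump χ) {c : ℝ} (hc : 0 < c)
    (φ : 𝓢(Rn n, ℂ)) : HasCompactSupport (hχ.truncate hc φ) :=
  (hχ.hasCompactSupport_comp_smul hc).mul_right

/-- The factor `χ(c x) - 1` vanishes where `c |x| < 1`. Elsewhere `1 ≤ c |x|`, so one extra power of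
`|x|`, absorbed by the seminorm of index `k + 1`, buys the factor `c`. -/
lemma IsLPBump.exists_seminorm_truncate_sub_le (hχ : IsLPBump χ) (φ : 𝓢(Rn n, ℂ)) (k l : ℕ) :
    ∃ C, ∀ c : ℝ, ∀ hc : 0 < c, c ≤ 1 →
      SchwartzMap.seminorm ℂ k l (hχ.truncate hc φ - φ) ≤ c * C := by
  set h : Rn n → ℂ := fun x => (χ x : ℂ) - 1 with hh
  have hsm : ContDiff ℝ ∞ h := by
    have := hχ.contDiff_comp_smul 1
    simp only [one_smul] at this
    exact this.sub contDiff_const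
  have hB : ∀ i, ∃ B, 0 ≤ B ∧ ∀ x, ‖iteratedFDeriv ℝ i h x‖ ≤ B := by
    intro i
    refine ⟨SchwartzMap.seminorm ℝ 0 i (hχ.schwartz one_pos) + 1, by positivity, fun x => ?_⟩
    have h1 : h = (hχ.schwartz one_pos : Rn n → ℂ) - fun _ => (1 : ℂ) := by
      ext y; simp [hh]
    rw [h1, iteratedFDeriv_sub ((hχ.schwartz one_pos).smooth i) contDiff_const]
    refine (norm_sub_le _ _).trans ?_
    gcongr
    · exact SchwartzMap.norm_iteratedFDeriv_le_seminorm ℝ _ _ _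
    · rcases Nat.eq_zero_or_pos i with rfl | hi
      · simp
      · simp [iteratedFDeriv_const_of_ne hi.ne']
  choose B hB0 hB using hB
  refine ⟨∑ i ∈ Finset.range (l + 1), (l.choose i : ℝ) * B i *
    SchwartzMap.seminorm ℝ (k + 1) (l - i) φ, fun c hc hc1 => ?_⟩
  refine SchwartzMap.seminorm_le_bound ℂ k l _ (by
    have : ∀ i, 0 ≤ SchwartzMap.seminorm ℝ (k + 1) (l - i) φ := fun i => apply_nonneg _ _
    exact mul_nonneg hc.le (Finset.sum_nonneg fun i _ =>
      mul_nonneg (mul_nonneg (by positivity) (hB0 i)) (this i))) fun x => ?_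
  have hfun : ((hχ.truncate hc φ - φ : 𝓢(Rn n, ℂ)) : Rn n → ℂ) = fun y => h (c • y) * φ y := by
    ext y
    simp only [sub_apply, hχ.truncate_apply, hh]
    ring
  rw [hfun]
  have hsum0 : 0 ≤ c * ∑ i ∈ Finset.range (l + 1), (l.choose i : ℝ) * B i *
      SchwartzMap.seminorm ℝ (k + 1) (l - i) φ := by
    have : ∀ i, 0 ≤ SchwartzMap.seminorm ℝ (k + 1) (l - i) φ := fun i => apply_nonneg _ _
    exact mul_nonneg hc.le (Finset.sum_nonneg fun i _ =>
      mul_nonneg (mul_nonneg (by positivity) (hB0 i)) (this i))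
  rcases lt_or_ge (c * ‖x‖) 1 with hx | hx
  · have hev : (fun y => h (c • y) * φ y) =ᶠ[𝓝 x] fun _ => 0 := by
      have : ∀ᶠ y in 𝓝 x, c * ‖y‖ < 1 :=
        (continuous_const.mul continuous_norm).continuousAt.eventually_lt continuousAt_const hx
      filter_upwards [this] with y hy
      have : χ (c • y) = 1 := hχ.eq_one _ (by
        rw [norm_smul, Real.norm_of_nonneg hc.le]; exact hy.le)
      simp [hh, this]
    rw [(Filter.EventuallyEq.iteratedFDeriv ℝ hev l).eq_of_nhds]
    rw [iteratedFDeriv_fun_zero]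
    simpa using hsum0
  · have hl := norm_iteratedFDeriv_mul_le (𝕜 := ℝ) (N := ∞) (n := l)
      (hsm.comp (contDiff_id.const_smul c)) (φ.smooth ⊤) x (by exact_mod_cast le_top)
    refine (mul_le_mul_of_nonneg_left hl (by positivity)).trans ?_
    rw [Finset.mul_sum, Finset.mul_sum]
    refine Finset.sum_le_sum fun i _ => ?_
    have h1 : ‖iteratedFDeriv ℝ i (h ∘ fun y => c • id y) x‖ ≤ B i := by
      have := iteratedFDeriv_comp_const_smul (𝕜 := ℝ) (i := i) c (f := h) (hsm.of_le (by
        exact_mod_cast le_top))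
      change ‖iteratedFDeriv ℝ i (fun z => h (c • z)) x‖ ≤ B i
      rw [this]
      simp only [norm_smul, norm_pow, Real.norm_of_nonneg hc.le]
      calc c ^ i * ‖iteratedFDeriv ℝ i h (c • x)‖ ≤ 1 * B i := by
            gcongr
            · exact pow_le_one₀ hc.le hc1
            · exact hB i _
        _ = B i := one_mul _
    have h2 := SchwartzMap.le_seminorm ℝ (k + 1) (l - i) φ x
    calc ‖x‖ ^ k * ((l.choose i : ℝ) * ‖iteratedFDeriv ℝ i (h ∘ fun y => c • id y) x‖ *
          ‖iteratedFDeriv ℝ (l - i) φ x‖)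
        ≤ ‖x‖ ^ k * ((l.choose i : ℝ) * B i * ‖iteratedFDeriv ℝ (l - i) φ x‖) := by gcongr
      _ ≤ (c * ‖x‖) * (‖x‖ ^ k * ((l.choose i : ℝ) * B i * ‖iteratedFDeriv ℝ (l - i) φ x‖)) := by
          refine le_mul_of_one_le_left ?_ hx
          have := hB0 i
          positivity
      _ = c * ((l.choose i : ℝ) * B i * (‖x‖ ^ (k + 1) * ‖iteratedFDeriv ℝ (l - i) φ x‖)) := by
          ring
      _ ≤ c * ((l.choose i : ℝ) * B i * SchwartzMap.seminorm ℝ (k + 1) (l - i) φ) := by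
          have := hB0 i
          gcongr

lemma IsLPBump.tendsto_truncate (hχ : IsLPBump χ) (φ : 𝓢(Rn n, ℂ)) :
    Tendsto (fun k : ℕ => hχ.truncate (c := ((k : ℝ) + 1)⁻¹) (by positivity) φ) atTop (𝓝 φ) := by
  rw [(schwartz_withSeminorms ℂ (Rn n) ℂ).tendsto_nhds]
  rintro ⟨k, l⟩ ε hε
  obtain ⟨C, hC⟩ := hχ.exists_seminorm_truncate_sub_le φ k l
  have h0 : Tendsto (fun j : ℕ => ((j : ℝ) + 1)⁻¹ * C) atTop (𝓝 0) := by
    have := tendsto_one_div_add_atTop_nhds_zero_nat (𝕜 := ℝ)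
    simpa using this.mul_const C
  filter_upwards [h0.eventually_lt_const hε] with j hj
  refine (hC _ (by positivity) ?_).trans_lt hj
  rw [inv_le_one_iff₀]
  right
  linarith [(Nat.cast_nonneg j : (0 : ℝ) ≤ j)]

/-- A tempered distribution given by an integrable function acts on all Schwartz functions by
integration. -/
lemma IsGivenBy.apply_eq_integral (hχ : IsLPBump χ) {T : 𝓢'(Rn n, ℂ)} {f : Rn n → ℝ}
    (hT : IsGivenBy T f) (hf : Integrable f) (φ : 𝓢(Rn n, ℂ)) :
    T φ = ∫ x, φ x * (f x : ℂ) := by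
  -- The identity is known for compactly supported truncations. The left side converges by
  -- continuity of `T`, the right side by dominated convergence.
  have h1 := (map_continuous T).tendsto φ |>.comp (hχ.tendsto_truncate φ)
  refine tendsto_nhds_unique h1 ?_
  have h2 : ∀ k : ℕ, T (hχ.truncate (c := ((k : ℝ) + 1)⁻¹) (by positivity) φ) =
      ∫ x, (χ (((k : ℝ) + 1)⁻¹ • x) : ℂ) * φ x * (f x : ℂ) := fun k => by
    rw [hT.2 _ (hχ.hasCompactSupport_truncate _ φ)]
    simp
  simp only [Function.comp_def, h2]
  set Mχ := SchwartzMap.seminorm ℝ 0 0 (hχ.schwartz one_pos) with hMχ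
  have hMχb : ∀ x, ‖(χ x : ℂ)‖ ≤ Mχ := fun x => by
    simpa using SchwartzMap.norm_le_seminorm ℝ (hχ.schwartz one_pos) x
  set Mφ := SchwartzMap.seminorm ℝ 0 0 φ with hMφ
  refine tendsto_integral_of_dominated_convergence (fun x => Mχ * Mφ * ‖f x‖) ?_
    (hf.norm.const_mul _) ?_ ?_
  · intro k
    exact (((hχ.contDiff_comp_smul _).continuous.mul φ.continuous).aestronglyMeasurable).mul
      hf.ofReal.aestronglyMeasurable
  · intro k
    refine Filter.Eventually.of_forall fun x => ?_
    rw [norm_mul, norm_mul, Complex.norm_real (f x)]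
    have : 0 ≤ Mχ := apply_nonneg _ _
    gcongr
    · exact hMχb _
    · exact SchwartzMap.norm_le_seminorm ℝ φ x
  · refine Filter.Eventually.of_forall fun x => ?_
    refine Tendsto.congr' ?_ tendsto_const_nhds
    have h0 : Tendsto (fun j : ℕ => ((j : ℝ) + 1)⁻¹ * ‖x‖) atTop (𝓝 0) := by
      have := tendsto_one_div_add_atTop_nhds_zero_nat (𝕜 := ℝ)
      simpa using this.mul_const ‖x‖
    filter_upwards [h0.eventually_lt_const one_pos] with j hj
    have : χ (((j : ℝ) + 1)⁻¹ • x) = 1 := hχ.eq_one _ (by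
      rw [norm_smul, Real.norm_of_nonneg (by positivity)]
      exact hj.le)
    simp [this]

end Cutoff

/-! ### Littlewood-Paley projectors as convolutions. -/

section LittlewoodPaley

variable {n : ℕ} {χ : Rn n → ℝ}

/-- The kernel whose Fourier transform is `χ(2π ξ)`. -/
noncomputable def IsLPBump.kernel (hχ : IsLPBump χ) : 𝓢(Rn n, ℂ) :=
  𝓕⁻ (hχ.schwartz (c := 2 * Real.pi) (by positivity))

/-- The kernel of the low-frequency projector `P_{≤ N}`. -/
noncomputable def IsLPBump.lowKernel (hχ : IsLPBump χ) (N : ℝ) (hN : N ≠ 0) : 𝓢(Rn n, ℂ) :=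
  schwartzDil N hN hχ.kernel

lemma IsLPBump.fourier_lowKernel (hχ : IsLPBump χ) {N : ℝ} (hN : 0 < N) (ξ : Rn n) :
    𝓕 (hχ.lowKernel N hN.ne') ξ = χ ((2 * Real.pi / N) • ξ) := by
  rw [IsLPBump.lowKernel, fourier_schwartzDil hN, IsLPBump.kernel,
    FourierTransform.fourier_fourierInv_eq, hχ.schwartz_apply, smul_smul]
  rfl

lemma IsLPBump.integral_kernel (hχ : IsLPBump χ) : ∫ x, hχ.kernel x = 1 := by
  have h : 𝓕 hχ.kernel 0 = 1 := by
    rw [IsLPBump.kernel, FourierTransform.fourier_fourierInv_eq, hχ.schwartz_apply,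
      hχ.eq_one _ (by simp)]
    simp
  rw [SchwartzMap.fourier_coe, Real.fourier_eq] at h
  simpa using h

/-- The low-frequency projector at twice the frequency acts as the identity. -/
lemma IsLPBump.fourier_lowKernel_mul (hχ : IsLPBump χ) {N N' : ℝ} (hN : 0 < N) (hN' : 2 * N ≤ N')
    (hN'0 : 0 < N') (ξ : Rn n) :
    𝓕 (hχ.lowKernel N hN.ne') ξ * 𝓕 (hχ.lowKernel N' hN'0.ne') ξ =
      𝓕 (hχ.lowKernel N hN.ne') ξ := by
  rw [hχ.fourier_lowKernel hN, hχ.fourier_lowKernel hN'0]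
  -- The first symbol lives on `|k| ≤ 2N ≤ N'`, where the second equals one.
  by_cases h : χ ((2 * Real.pi / N) • ξ) = 0
  · simp [h]
  · have h1 := hχ.support_subset h
    rw [mem_closedBall_zero_iff, norm_smul, Real.norm_of_nonneg (by positivity)] at h1
    rw [hχ.eq_one ((2 * Real.pi / N') • ξ)]
    · simp
    · rw [norm_smul, Real.norm_of_nonneg (by positivity)]
      calc 2 * Real.pi / N' * ‖ξ‖ ≤ 2 * Real.pi / (2 * N) * ‖ξ‖ := by gcongr
        _ = (2 * Real.pi / N * ‖ξ‖) / 2 := by field_simp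
        _ ≤ 1 := by linarith

/-- Fourier multipliers whose symbol is the Fourier transform of a kernel, tested with a Schwartz
function. -/
lemma fourier_smulLeft_fourierInv_apply {σ : Rn n → ℂ} {κ : 𝓢(Rn n, ℂ)} (hσ : ∀ ξ, 𝓕 κ ξ = σ ξ)
    (φ : 𝓢(Rn n, ℂ)) (y : Rn n) :
    𝓕 (SchwartzMap.smulLeftCLM ℂ σ (𝓕⁻ φ)) y = ∫ x, κ (x - y) * φ x := by
  -- The inverse transform of `φ` is the transform of its reflection, so multiplying by the symbol
  -- gives the transform of a convolution with `κ`.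
  set φ' : 𝓢(Rn n, ℂ) := SchwartzMap.compCLMOfContinuousLinearEquiv ℂ
    (LinearIsometryEquiv.neg ℝ (E := Rn n)).toContinuousLinearEquiv φ with hφ'
  have hφ'a : ∀ x, φ' x = φ (-x) := fun x => rfl
  have hσ' : σ = (𝓕 κ : 𝓢(Rn n, ℂ)) := funext fun ξ => (hσ ξ).symm
  have h1 : 𝓕⁻ φ = 𝓕 φ' := by
    ext ξ
    rw [SchwartzMap.fourierInv_coe, SchwartzMap.fourier_coe,
      Real.fourierInv_eq_fourier_comp_neg]
    rfl
  have h2 : SchwartzMap.smulLeftCLM ℂ σ (𝓕⁻ φ) =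
      𝓕 (SchwartzMap.convolution (ContinuousLinearMap.mul ℂ ℂ) κ φ') := by
    ext ξ
    rw [hσ', SchwartzMap.smulLeftCLM_apply_apply (SchwartzMap.hasTemperateGrowth _), h1,
      SchwartzMap.fourier_convolution, SchwartzMap.pairing_apply_apply]
    rfl
  have h3 : 𝓕 (SchwartzMap.smulLeftCLM ℂ σ (𝓕⁻ φ)) y =
      𝓕⁻ (SchwartzMap.smulLeftCLM ℂ σ (𝓕⁻ φ)) (-y) := by
    rw [SchwartzMap.fourierInv_coe, SchwartzMap.fourier_coe, Real.fourierInv_eq_fourier_neg,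
      neg_neg]
  rw [h3, h2, FourierTransform.fourierInv_fourier_eq, SchwartzMap.convolution_apply,
    convolution_def, ← integral_sub_right_eq_self (fun t => (ContinuousLinearMap.mul ℂ ℂ) (κ t)
      (φ' (-y - t))) y]
  congr 1 with x
  rw [ContinuousLinearMap.mul_apply', hφ'a]
  congr 2
  abel

/-- A Fourier multiplier applied to an integrable function is the convolution with the kernel. -/
lemma fourierMultiplier_apply_eq_integral {σ : Rn n → ℂ} {κ : 𝓢(Rn n, ℂ)} (hσ : ∀ ξ, 𝓕 κ ξ = σ ξ)
    {T : 𝓢'(Rn n, ℂ)} {f : Rn n → ℂ} (hf : Integrable f) (hT : ∀ φ, T φ = ∫ x, φ x * f x)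
    (φ : 𝓢(Rn n, ℂ)) :
    TemperedDistribution.fourierMultiplierCLM ℂ σ T φ = ∫ x, φ x * schwartzConv f κ x := by
  rw [TemperedDistribution.fourierMultiplierCLM_apply_apply, hT]
  simp_rw [fourier_smulLeft_fourierInv_apply hσ, schwartzConv, ← integral_const_mul,
    ← integral_mul_const]
  rw [integral_integral_swap]
  · congr 1 with x
    congr 1 with t
    ring
  · have h1 := hf.convolution_integrand (ContinuousLinearMap.mul ℂ ℂ) (κ.integrable (μ := volume))
    have h2 := h1.bdd_mul (c := SchwartzMap.seminorm ℝ 0 0 φ)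
      (f := fun p : Rn n × Rn n => φ p.1) (φ.continuous.comp continuous_fst).aestronglyMeasurable
      (Filter.Eventually.of_forall fun p => SchwartzMap.norm_le_seminorm ℝ φ p.1)
    refine h2.swap.congr (Filter.Eventually.of_forall fun p => ?_)
    simp [Function.uncurry]
    ring

/-- Any `L¹` representative of the projected distribution agrees with the convolution almost
everywhere, so the infimum ranges over at most one class; if it is empty the bound is trivial. -/
lemma lintegral_enorm_schwartzConv_le_distL1Norm {σ : Rn n → ℂ} {κ : 𝓢(Rn n, ℂ)}
    (hσ : ∀ ξ, 𝓕 κ ξ = σ ξ) {T : 𝓢'(Rn n, ℂ)} {f : Rn n → ℂ} (hf : Integrable f)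
    (hT : ∀ φ, T φ = ∫ x, φ x * f x) :
    ∫⁻ x, ‖schwartzConv f κ x‖ₑ ≤
      distL1Norm (TemperedDistribution.fourierMultiplierCLM ℂ σ T) := by
  refine le_iInf₂ fun h hh => ?_
  have hae : ∀ᵐ x, h x = schwartzConv f κ x := by
    refine ae_eq_of_integral_contDiff_smul_eq (L1.integrable_coeFn h).locallyIntegrable
      (integrable_schwartzConv hf κ).locallyIntegrable fun g hg hgc => ?_
    have hg₁ : HasCompactSupport (Complex.ofRealCLM ∘ g) := hgc.comp_left rfl
    have hg₂ : ContDiff ℝ ∞ (Complex.ofRealCLM ∘ g) := by fun_prop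
    have h1 := fourierMultiplier_apply_eq_integral hσ hf hT (hg₁.toSchwartzMap hg₂)
    rw [← hh, Lp.toTemperedDistribution_apply] at h1
    simpa using h1
  rw [Lp.enorm_def, eLpNorm_one_eq_lintegral_enorm]
  refine le_of_eq (lintegral_congr_ae ?_)
  filter_upwards [hae] with x hx
  rw [hx]

/-- The kernel of the low-frequency projector at frequency `2 ^ j`. -/
noncomputable def IsLPBump.dyadicKernel (hχ : IsLPBump χ) (j : ℕ) : 𝓢(Rn n, ℂ) :=
  hχ.lowKernel ((2 : ℝ) ^ j) (by positivity)

/-- The `L¹` norms of the dyadic pieces of a function of finite Besov norm decay. -/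
lemma exists_integral_norm_dyadic_le (hχ : IsLPBump χ) {T : 𝓢'(Rn n, ℂ)} {f : Rn n → ℝ}
    (hT : IsGivenBy T f) (hf : Integrable f) {σ : ℝ} (hb : besovNorm χ σ T < ⊤) :
    ∃ S : ℝ, 0 ≤ S ∧ ∀ j : ℕ,
      ∫ x, ‖schwartzConv (fun x => (f x : ℂ)) (hχ.dyadicKernel (j + 1) - hχ.dyadicKernel j) x‖ ≤
        S * ((2 : ℝ) ^ (j + 1)) ^ (-σ) := by
  refine ⟨(besovNorm χ σ T).toReal, ENNReal.toReal_nonneg, fun j => ?_⟩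
  set κ := hχ.dyadicKernel (j + 1) - hχ.dyadicKernel j with hκ
  have hfc : Integrable fun x => (f x : ℂ) := hf.ofReal
  -- The symbol of `P_N` with `N = 2^{j+1}` is a difference of low-pass symbols at `2^{j+1}` and
  -- `2^j`. Its `L¹` norm is then read off from a single term of the Besov sum.
  have hsym : ∀ ξ, 𝓕 κ ξ =
      ((χ ((2 * Real.pi / (2 : ℝ) ^ ((j + 1 : ℕ) : ℤ)) • ξ) -
        χ ((2 * (2 * Real.pi / (2 : ℝ) ^ ((j + 1 : ℕ) : ℤ))) • ξ) : ℝ) : ℂ) := by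
    intro ξ
    have h1 : 𝓕 κ = 𝓕 (hχ.dyadicKernel (j + 1)) - 𝓕 (hχ.dyadicKernel j) := by
      simpa using map_sub (FourierTransform.fourierCLM ℂ 𝓢(Rn n, ℂ)) (hχ.dyadicKernel (j + 1))
        (hχ.dyadicKernel j)
    rw [h1, sub_apply, IsLPBump.dyadicKernel, IsLPBump.dyadicKernel,
      hχ.fourier_lowKernel (by positivity), hχ.fourier_lowKernel (by positivity), zpow_natCast]
    have h2 : 2 * (2 * Real.pi / (2 : ℝ) ^ (j + 1)) = 2 * Real.pi / 2 ^ j := by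
      rw [pow_succ]; field_simp
    rw [h2]
    push_cast
    rfl
  have h1 : ∫⁻ x, ‖schwartzConv (fun x => (f x : ℂ)) κ x‖ₑ ≤
      distL1Norm (lpProj χ ((2 : ℝ) ^ ((j + 1 : ℕ) : ℤ)) T) :=
    lintegral_enorm_schwartzConv_le_distL1Norm hsym hfc (hT.apply_eq_integral hχ hf)
  have h2 : ENNReal.ofReal (((2 : ℝ) ^ ((j + 1 : ℕ) : ℤ)) ^ σ) *
      distL1Norm (lpProj χ ((2 : ℝ) ^ ((j + 1 : ℕ) : ℤ)) T) ≤ besovNorm χ σ T :=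
    ENNReal.le_tsum ((j + 1 : ℕ) : ℤ)
  have hconv : Integrable (schwartzConv (fun x => (f x : ℂ)) κ) := integrable_schwartzConv hfc κ
  rw [zpow_natCast] at h1 h2
  have h3 : ENNReal.ofReal (((2 : ℝ) ^ (j + 1)) ^ σ *
      ∫ x, ‖schwartzConv (fun x => (f x : ℂ)) κ x‖) ≤ besovNorm χ σ T := by
    rw [ENNReal.ofReal_mul (by positivity), ofReal_integral_norm_eq_lintegral_enorm hconv]
    exact (mul_le_mul_right h1 _).trans h2
  have h4 := (ENNReal.ofReal_le_iff_le_toReal hb.ne).1 h3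
  rw [Real.rpow_neg (by positivity), ← div_eq_mul_inv, le_div_iff₀ (by positivity)]
  linarith

end LittlewoodPaley

/-! ### Summing increments in `L¹`. -/

section Telescoping

open Filter Topology

variable {n : ℕ}

/-- If integrable functions `D j` converge to `g` in the sense of distributions and their increments
are summable in `L¹`, then the distance of `D J` to `g` in `L¹` is at most the tail of the series. -/
lemma integral_norm_sub_le_tsum {D : ℕ → Rn n → ℂ} {g : Rn n → ℂ} (hD : ∀ j, Integrable (D j))
    (hg : Integrable g)
    (hlim : ∀ φ : Rn n → ℝ, ContDiff ℝ ∞ φ → HasCompactSupport φ →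
      Tendsto (fun j => ∫ x, φ x • D j x) atTop (𝓝 (∫ x, φ x • g x)))
    {b : ℕ → ℝ} (hb : Summable b) (hDb : ∀ j, ∫ x, ‖D (j + 1) x - D j x‖ ≤ b j) :
    ∫ x, ‖D 0 x - g x‖ ≤ ∑' j, b j := by
  set H : ℕ → Rn n → ℂ := fun j x => D (j + 1) x - D j x with hH
  have hHi : ∀ j, Integrable (H j) := fun j => (hD (j + 1)).sub (hD j)
  have hb0 : ∀ j, 0 ≤ b j := fun j => (integral_nonneg fun x => norm_nonneg _).trans (hDb j)
  have hpart : ∀ m x, ∑ i ∈ Finset.range m, H i x = D m x - D 0 x := fun m x =>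
    Finset.sum_range_sub (fun i => D i x) m
  have hlint : ∫⁻ x, ∑' j, ‖H j x‖ₑ ≤ ENNReal.ofReal (∑' j, b j) := by
    rw [lintegral_tsum fun j => (hHi j).aestronglyMeasurable.enorm,
      ENNReal.ofReal_tsum_of_nonneg hb0 hb]
    refine ENNReal.tsum_le_tsum fun j => ?_
    rw [← ofReal_integral_norm_eq_lintegral_enorm (hHi j)]
    exact ENNReal.ofReal_le_ofReal (hDb j)
  have hsum : ∀ᵐ x, Summable fun j => H j x := by
    have h1 := ae_lt_top' (AEMeasurable.tsum fun j =>
      (hHi j).aestronglyMeasurable.enorm) (hlint.trans_lt ENNReal.ofReal_lt_top).ne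
    filter_upwards [h1] with x hx
    exact Summable.of_enorm hx.ne
  -- Summability in `L¹` makes the telescoping series converge almost everywhere to an integrable
  -- function. As `D j → g` is only distributional, this sum is then identified with `g - D 0` by
  -- testing.
  set F : Rn n → ℂ := fun x => ∑' j, H j x with hF
  have hFm : AEStronglyMeasurable F volume := by
    refine aestronglyMeasurable_of_tendsto_ae atTop
      (f := fun m x => ∑ i ∈ Finset.range m, H i x) (fun m => ?_) ?_
    · exact (integrable_finsetSum _ fun i _ => hHi i).aestronglyMeasurable
    · filter_upwards [hsum] with x hx
      exact hx.hasSum.tendsto_sum_nat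
  have hFle : ∫⁻ x, ‖F x‖ₑ ≤ ENNReal.ofReal (∑' j, b j) :=
    (lintegral_mono fun x => enorm_tsum_le_tsum_enorm).trans hlint
  have hFi : Integrable F := ⟨hFm, hFle.trans_lt ENNReal.ofReal_lt_top⟩
  have hFg : ∀ᵐ x, F x = g x - D 0 x := by
    refine ae_eq_of_integral_contDiff_smul_eq hFi.locallyIntegrable
      (hg.sub (hD 0)).locallyIntegrable fun φ hφ hφc => ?_
    obtain ⟨Mφ, hMφ⟩ := hφ.continuous.bounded_above_of_compact_support hφc
    have hint : ∀ {k : Rn n → ℂ}, Integrable k → Integrable fun x => φ x • k x := fun hk =>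
      hk.bdd_smul Mφ hφ.continuous.aestronglyMeasurable (Filter.Eventually.of_forall hMφ)
    have hM0 : 0 ≤ Mφ := (norm_nonneg _).trans (hMφ 0)
    have h1 := hasSum_integral_of_summable_integral_norm (F := fun j x => φ x • H j x)
      (fun j => hint (hHi j)) (by
        refine Summable.of_nonneg_of_le (fun j => integral_nonneg fun x => norm_nonneg _)
          (fun j => ?_) (hb.mul_left Mφ)
        calc ∫ x, ‖φ x • H j x‖ ≤ ∫ x, Mφ * ‖H j x‖ := by
              refine integral_mono (hint (hHi j)).norm ((hHi j).norm.const_mul _) fun x => ?_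
              simp only [norm_smul]
              gcongr
              exact hMφ x
          _ = Mφ * ∫ x, ‖H j x‖ := integral_const_mul _ _
          _ ≤ Mφ * b j := by gcongr; exact hDb j)
    have h2 : ∫ x, ∑' j, φ x • H j x = ∫ x, φ x • F x := by
      refine integral_congr_ae ?_
      filter_upwards [hsum] with x hx
      exact hx.tsum_const_smul _
    rw [h2] at h1
    refine tendsto_nhds_unique h1.tendsto_sum_nat ?_
    have h3 : ∀ m, ∑ i ∈ Finset.range m, ∫ x, φ x • H i x =
        (∫ x, φ x • D m x) - ∫ x, φ x • D 0 x := by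
      intro m
      rw [← integral_finsetSum _ fun i _ => hint (hHi i), ← integral_sub (hint (hD m))
        (hint (hD 0))]
      congr 1 with x
      rw [← Finset.smul_sum, hpart, smul_sub]
    simp_rw [h3, smul_sub]
    rw [integral_sub (hint hg) (hint (hD 0))]
    exact (hlim φ hφ hφc).sub tendsto_const_nhds
  have h4 : ∫ x, ‖D 0 x - g x‖ = ∫ x, ‖F x‖ := by
    refine integral_congr_ae ?_
    filter_upwards [hFg] with x hx
    rw [hx, norm_sub_rev]
  rw [h4, ← ENNReal.ofReal_le_ofReal_iff (tsum_nonneg hb0),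
    ofReal_integral_norm_eq_lintegral_enorm hFi]
  exact hFle

end Telescoping

/-! ### Weak derivatives and Lipschitz representatives. -/

section WeakDerivative

variable {n : ℕ}

lemma integral_mul_partialDeriv_eq_neg {w φ : Rn n → ℝ} (hw : ContDiff ℝ 1 w)
    (hφ : ContDiff ℝ ∞ φ) (hφc : HasCompactSupport φ) (j : Fin n) :
    ∫ x, w x * partialDeriv j φ x = -∫ x, partialDeriv j w x * φ x := by
  have hφd : Continuous fun x => fderiv ℝ φ x (EuclideanSpace.single j 1) :=
    (hφ.continuous_fderiv (by norm_num)).clm_apply continuous_const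
  have hwd : Continuous fun x => fderiv ℝ w x (EuclideanSpace.single j 1) :=
    (hw.continuous_fderiv (by norm_num)).clm_apply continuous_const
  refine integral_mul_fderiv_eq_neg_fderiv_mul_of_integrable ?_ ?_ ?_
    (fun x _ => (hw.differentiable (by norm_num)).differentiableAt)
    (fun x _ => (hφ.differentiable (by norm_num)).differentiableAt)
  · exact (hwd.mul hφ.continuous).integrable_of_hasCompactSupport hφc.mul_left
  · exact (hw.continuous.mul hφd).integrable_of_hasCompactSupport
      (hφc.fderiv_apply ℝ _).mul_left
  · exact (hw.continuous.mul hφ.continuous).integrable_of_hasCompactSupport hφc.mul_left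

/-- The weak derivative relation between `f` and `g` tested with all smooth real functions with
compact support, in the direction `e_j`. -/
def IsWeakPartialDeriv (j : Fin n) (f g : Rn n → ℝ) : Prop :=
  ∀ φ : Rn n → ℝ, ContDiff ℝ ∞ φ → HasCompactSupport φ →
    ∫ x, f x * partialDeriv j φ x = -∫ x, g x * φ x

/-- If `f` and `g` vanish off a bounded set, then smooth complex test functions need not have
compact support. -/
lemma IsWeakPartialDeriv.integral_mul_fderiv {j : Fin n} {f g : Rn n → ℝ}
    (h : IsWeakPartialDeriv j f g) (hf : Integrable f) (hg : Integrable g) {A : Set (Rn n)}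
    (hA : Bornology.IsBounded A)
    (hfA : ∀ᵐ x, x ∉ A → f x = 0) (hgA : ∀ᵐ x, x ∉ A → g x = 0)
    (φ : Rn n → ℂ) (hφ : ContDiff ℝ ∞ φ) :
    ∫ t, (f t : ℂ) * fderiv ℝ φ t (EuclideanSpace.single j 1) = -∫ t, (g t : ℂ) * φ t := by
  obtain ⟨R, hR0, hR⟩ : ∃ R > 0, A ⊆ Metric.ball (0 : Rn n) R := by
    obtain ⟨R, hR⟩ := hA.subset_ball_lt 0 0
    exact ⟨R, hR⟩
  -- Multiplying a test function by `θ` makes its support compact without changing it near `A`, so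
  -- neither integral changes.
  let θ : ContDiffBump (0 : Rn n) := ⟨R, 2 * R, hR0, by linarith⟩
  have hloc : ∀ ψ : Rn n → ℝ, ∀ x ∈ A, θ x * ψ x = ψ x ∧
      partialDeriv j (fun y => θ y * ψ y) x = partialDeriv j ψ x := by
    intro ψ x hx
    have h1 : ∀ y ∈ Metric.ball (0 : Rn n) R, θ y * ψ y = ψ y := fun y hy => by
      rw [θ.one_of_mem_closedBall (Metric.ball_subset_closedBall hy), one_mul]
    refine ⟨h1 x (hR hx), ?_⟩
    have h2 : (fun y => θ y * ψ y) =ᶠ[nhds x] ψ :=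
      Filter.eventually_of_mem (Metric.isOpen_ball.mem_nhds (hR hx)) h1
    rw [partialDeriv, partialDeriv, h2.fderiv_eq]
  have hreal : ∀ ψ : Rn n → ℝ, ContDiff ℝ ∞ ψ →
      ∫ x, f x * partialDeriv j ψ x = -∫ x, g x * ψ x ∧
      Integrable (fun x => f x * partialDeriv j ψ x) ∧ Integrable fun x => g x * ψ x := by
    intro ψ hψ
    have hθψ : ContDiff ℝ ∞ fun y => θ y * ψ y := θ.contDiff.mul hψ
    have hθψc : HasCompactSupport fun y => θ y * ψ y := θ.hasCompactSupport.mul_right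
    have e1 : (fun x => f x * partialDeriv j (fun y => θ y * ψ y) x) =ᵐ[volume]
        fun x => f x * partialDeriv j ψ x := by
      filter_upwards [hfA] with x hx
      by_cases hxA : x ∈ A
      · simp only [(hloc ψ x hxA).2]
      · simp [hx hxA]
    have e2 : (fun x => g x * (θ x * ψ x)) =ᵐ[volume] fun x => g x * ψ x := by
      filter_upwards [hgA] with x hx
      by_cases hxA : x ∈ A
      · simp only [(hloc ψ x hxA).1]
      · simp [hx hxA]
    have hd : Continuous (partialDeriv j (fun y => θ y * ψ y)) :=
      (hθψ.continuous_fderiv (by norm_num)).clm_apply continuous_const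
    obtain ⟨B1, hB1⟩ := hd.bounded_above_of_compact_support (hθψc.fderiv_apply ℝ _)
    obtain ⟨B2, hB2⟩ := hθψ.continuous.bounded_above_of_compact_support hθψc
    refine ⟨?_, ?_, ?_⟩
    · rw [← integral_congr_ae e1, ← integral_congr_ae e2]
      exact h _ hθψ hθψc
    · exact (hf.mul_bdd hd.aestronglyMeasurable (Filter.Eventually.of_forall hB1)).congr e1
    · exact (hg.mul_bdd hθψ.continuous.aestronglyMeasurable
        (Filter.Eventually.of_forall hB2)).congr e2
  have hre : ContDiff ℝ ∞ fun x => (φ x).re := Complex.reCLM.contDiff.comp hφ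
  have him : ContDiff ℝ ∞ fun x => (φ x).im := Complex.imCLM.contDiff.comp hφ
  have hφd : ∀ x, DifferentiableAt ℝ φ x := fun x =>
    (hφ.differentiable (by norm_num)).differentiableAt
  have hdre : ∀ x, partialDeriv j (fun x => (φ x).re) x =
      (fderiv ℝ φ x (EuclideanSpace.single j 1)).re := fun x => by
    have h : HasFDerivAt (fun x => (φ x).re) (Complex.reCLM.comp (fderiv ℝ φ x)) x :=
      Complex.reCLM.hasFDerivAt.comp x (hφd x).hasFDerivAt
    rw [partialDeriv, h.fderiv]
    rfl
  have hdim : ∀ x, partialDeriv j (fun x => (φ x).im) x =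
      (fderiv ℝ φ x (EuclideanSpace.single j 1)).im := fun x => by
    have h : HasFDerivAt (fun x => (φ x).im) (Complex.imCLM.comp (fderiv ℝ φ x)) x :=
      Complex.imCLM.hasFDerivAt.comp x (hφd x).hasFDerivAt
    rw [partialDeriv, h.fderiv]
    rfl
  obtain ⟨r1, r2, r3⟩ := hreal _ hre
  obtain ⟨i1, i2, i3⟩ := hreal _ him
  have c1 : ∫ t, (f t : ℂ) * fderiv ℝ φ t (EuclideanSpace.single j 1) =
      (∫ x, f x * partialDeriv j (fun x => (φ x).re) x : ℝ) +
      (∫ x, f x * partialDeriv j (fun x => (φ x).im) x : ℝ) * Complex.I := by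
    rw [← integral_complex_ofReal, ← integral_complex_ofReal, ← integral_mul_const,
      ← integral_add r2.ofReal (i2.ofReal.mul_const _)]
    congr 1 with t
    rw [hdre, hdim]
    conv_lhs => rw [← Complex.re_add_im (fderiv ℝ φ t (EuclideanSpace.single j 1))]
    simp only [Complex.ofReal_mul]
    ring
  have c2 : ∫ t, (g t : ℂ) * φ t = (∫ x, g x * (φ x).re : ℝ) +
      (∫ x, g x * (φ x).im : ℝ) * Complex.I := by
    rw [← integral_complex_ofReal, ← integral_complex_ofReal, ← integral_mul_const,
      ← integral_add r3.ofReal (i3.ofReal.mul_const _)]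
    congr 1 with t
    conv_lhs => rw [← Complex.re_add_im (φ t)]
    simp only [Complex.ofReal_mul]
    ring
  rw [c1, c2, r1, i1]
  push_cast
  ring

lemma norm_le_of_forall_norm_single_le {F : Type*} [NormedAddCommGroup F] [NormedSpace ℝ F]
    (A : Rn n →L[ℝ] F) {B : ℝ} (hB0 : 0 ≤ B)
    (hB : ∀ j, ‖A (EuclideanSpace.single j 1)‖ ≤ B) : ‖A‖ ≤ n * B := by
  refine A.opNorm_le_bound (by positivity) fun x => ?_
  have hx : x = ∑ j, x j • EuclideanSpace.single j (1 : ℝ) := by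
    ext i
    simp [Finset.sum_apply, Pi.single_apply]
  conv_lhs => rw [hx, map_sum]
  refine (norm_sum_le _ _).trans ?_
  calc ∑ j, ‖A (x j • EuclideanSpace.single j (1 : ℝ))‖ ≤ ∑ _j : Fin n, ‖x‖ * B := by
        refine Finset.sum_le_sum fun j _ => ?_
        rw [map_smul, norm_smul]
        gcongr
        · exact PiLp.norm_apply_le x j
        · exact hB j
    _ = n * B * ‖x‖ := by simp; ring

/-- An integrable function with bounded weak derivatives agrees a.e. with a Lipschitz function. -/
lemma exists_lipschitzWith_ae_eq {f : Rn n → ℝ} {g : Fin n → Rn n → ℝ} (hf : Integrable f)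
    {B : ℝ} (hB0 : 0 ≤ B) (hB : ∀ j, ∀ᵐ x, |g j x| ≤ B)
    (hfg : ∀ j, ∀ φ : Rn n → ℂ, ContDiff ℝ ∞ φ →
      ∫ t, (f t : ℂ) * fderiv ℝ φ t (EuclideanSpace.single j 1) = -∫ t, (g j t : ℂ) * φ t) :
    ∃ (L : ℝ≥0) (f' : Rn n → ℝ), LipschitzWith L f' ∧ f =ᵐ[volume] f' := by
  let φ : ℕ → ContDiffBump (0 : Rn n) := fun k =>
    ⟨1 / ((k : ℝ) + 1), 2 * (1 / ((k : ℝ) + 1)), by positivity, by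
      have : 0 < 1 / ((k : ℝ) + 1) := by positivity
      linarith⟩
  have hc : ∀ k, HasCompactSupport (Complex.ofRealCLM ∘ (φ k).normed volume) := fun k =>
    (φ k).hasCompactSupport_normed.comp_left rfl
  have hs : ∀ k, ContDiff ℝ ∞ (Complex.ofRealCLM ∘ (φ k).normed volume) := fun k =>
    Complex.ofRealCLM.contDiff.comp (φ k).contDiff_normed
  set ρ : ℕ → 𝓢(Rn n, ℂ) := fun k => (hc k).toSchwartzMap (hs k) with hρ
  have hρa : ∀ k x, ρ k x = ((φ k).normed volume x : ℂ) := fun k x => rfl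
  have hρn : ∀ k, ∫ x, ‖ρ k x‖ = 1 := fun k => by
    simp_rw [hρa, Complex.norm_real, Real.norm_of_nonneg ((φ k).nonneg_normed _)]
    exact (φ k).integral_normed
  have hfc : Integrable fun x => (f x : ℂ) := hf.ofReal
  set L : ℝ≥0 := ⟨n * B, by positivity⟩ with hL
  -- The gradient of a mollification is the mollification of the weak gradient, hence bounded
  -- uniformly in `k`.
  have hlip : ∀ k, LipschitzWith L (schwartzConv (fun x => (f x : ℂ)) (ρ k)) := by
    intro k
    refine lipschitzWith_of_nnnorm_fderiv_le (𝕜 := ℝ)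
      (fun x => (hasFDerivAt_schwartzConv hfc (ρ k) x).differentiableAt) fun x => ?_
    rw [← NNReal.coe_le_coe]
    refine norm_le_of_forall_norm_single_le _ hB0 fun j => ?_
    rw [fderiv_schwartzConv_apply hfc, schwartzConv_lineDeriv_of_weakDeriv (hfg j)]
    refine (norm_schwartzConv_le (B := B) ?_ (ρ k) x).trans_eq (by rw [hρn, mul_one])
    filter_upwards [hB j] with t ht
    rwa [Complex.norm_real]
  have hconv : ∀ᵐ x, Filter.Tendsto (fun k => schwartzConv (fun x => (f x : ℂ)) (ρ k) x)
      Filter.atTop (nhds (f x : ℂ)) := by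
    have h0 : Filter.Tendsto (fun k => (φ k).rOut) Filter.atTop (nhds 0) := by
      have := (tendsto_one_div_add_atTop_nhds_zero_nat (𝕜 := ℝ)).const_mul 2
      rwa [mul_zero] at this
    have := ContDiffBump.ae_convolution_tendsto_right_of_locallyIntegrable (K := 2) h0
      (Filter.Eventually.of_forall fun k => le_rfl) (μ := volume) hfc.locallyIntegrable
    filter_upwards [this] with x hx
    refine hx.congr fun k => ?_
    rw [convolution_eq_swap, schwartzConv]
    congr 1 with t
    rw [hρa]
    simp [mul_comm]
  set A := {x | Filter.Tendsto (fun k => schwartzConv (fun x => (f x : ℂ)) (ρ k) x)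
      Filter.atTop (nhds (f x : ℂ))} with hA
  -- The uniform Lipschitz bound passes to the limit on the set of convergence, which has full
  -- measure; the function is then extended from there.
  have hlipA : LipschitzOnWith L f A := by
    refine LipschitzOnWith.of_dist_le_mul fun x hx y hy => ?_
    have h1 : dist (f x) (f y) = dist (f x : ℂ) (f y : ℂ) := (Complex.isometry_ofReal.dist_eq _ _).symm
    rw [h1]
    exact le_of_tendsto (hx.dist hy) (Filter.Eventually.of_forall fun k => (hlip k).dist_le_mul x y)
  obtain ⟨f', hf', heq⟩ := hlipA.extend_real
  exact ⟨L, f', hf', hconv.mono fun x hx => heq hx⟩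

end WeakDerivative

/-! ### Bernstein estimates and low-frequency approximation. -/

section SmoothApproximation

open Filter Topology

variable {n : ℕ} {χ : Rn n → ℝ}

lemma schwartzConv_lineDeriv_congr {f h : Rn n → ℂ} (hf : Integrable f) (hh : Integrable h)
    {ρ σ : 𝓢(Rn n, ℂ)} (heq : schwartzConv f ρ = schwartzConv h σ) (m : Rn n) :
    schwartzConv f (∂_{m} ρ) = schwartzConv h (∂_{m} σ) := by
  funext x
  rw [← fderiv_schwartzConv_apply hf, heq, fderiv_schwartzConv_apply hh]

lemma partialDeriv_re_schwartzConv {f : Rn n → ℂ} (hf : Integrable f) (ρ : 𝓢(Rn n, ℂ))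
    (j : Fin n) : partialDeriv j (fun x => (schwartzConv f ρ x).re) =
      fun x => (schwartzConv f (∂_{EuclideanSpace.single j (1 : ℝ)} ρ) x).re := by
  funext x
  have h : HasFDerivAt (fun x => (schwartzConv f ρ x).re)
      (Complex.reCLM.comp (fderiv ℝ (schwartzConv f ρ) x)) x :=
    Complex.reCLM.hasFDerivAt.comp x (hasFDerivAt_schwartzConv hf ρ x).differentiableAt.hasFDerivAt
  rw [partialDeriv, h.fderiv, ← fderiv_schwartzConv_apply hf]
  rfl

lemma two_pow_rpow (k : ℕ) (t : ℝ) : ((2 : ℝ) ^ k) ^ t = ((2 : ℝ) ^ t) ^ k := by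
  rw [← Real.rpow_natCast, ← Real.rpow_mul (by norm_num), mul_comm,
    Real.rpow_mul (by norm_num), Real.rpow_natCast]

/-- The piece has frequencies at most `2 · 2^{i+1}`, where the low-pass symbol at `2^{i+2}` is one,
so it reproduces itself. Derivatives can then be put on that low-pass kernel instead of on the
piece. -/
lemma IsLPBump.schwartzConv_dyadic_piece (hχ : IsLPBump χ) {f : Rn n → ℂ} (hf : Integrable f)
    (i : ℕ) : schwartzConv f (hχ.dyadicKernel (i + 1) - hχ.dyadicKernel i) =
      schwartzConv (schwartzConv f (hχ.dyadicKernel (i + 1) - hχ.dyadicKernel i))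
        (hχ.dyadicKernel (i + 2)) := by
  refine (schwartzConv_schwartzConv hf fun ξ => ?_).symm
  have h1 : 𝓕 (hχ.dyadicKernel (i + 1) - hχ.dyadicKernel i) =
      𝓕 (hχ.dyadicKernel (i + 1)) - 𝓕 (hχ.dyadicKernel i) := by
    simpa using map_sub (FourierTransform.fourierCLM ℂ 𝓢(Rn n, ℂ)) (hχ.dyadicKernel (i + 1))
        (hχ.dyadicKernel i)
  have e : (2 : ℝ) ^ (i + 2) = 2 * 2 ^ (i + 1) := by ring
  have e' : (2 : ℝ) ^ (i + 2) = 4 * 2 ^ i := by ring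
  have h2 := hχ.fourier_lowKernel_mul (N := 2 ^ (i + 1)) (N' := 2 ^ (i + 2)) (by positivity)
    e.ge (by positivity) ξ
  have h3 := hχ.fourier_lowKernel_mul (N := 2 ^ i) (N' := 2 ^ (i + 2)) (by positivity)
    (by rw [e']; have : (0 : ℝ) < 2 ^ i := by positivity
        linarith) (by positivity) ξ
  rw [h1, sub_apply, sub_mul]
  exact (congrArg₂ (· - ·) h2 h3).symm

lemma IsLPBump.lineDeriv_dyadicKernel (hχ : IsLPBump χ) (m : Rn n) (j : ℕ) :
    ∂_{m} (hχ.dyadicKernel j) = (((2 : ℝ) ^ j : ℝ) : ℂ) •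
      schwartzDil ((2 : ℝ) ^ j) (by positivity) (∂_{m} hχ.kernel) :=
  lineDeriv_schwartzDil _ _ _ _

lemma IsLPBump.integral_norm_lineDeriv_dyadicKernel (hχ : IsLPBump χ) (m : Rn n) (j : ℕ) :
    ∫ x, ‖∂_{m} (hχ.dyadicKernel j) x‖ = (2 : ℝ) ^ j * ∫ x, ‖∂_{m} hχ.kernel x‖ := by
  rw [hχ.lineDeriv_dyadicKernel,
    ← integral_norm_schwartzDil (N := (2 : ℝ) ^ j) (by positivity) (∂_{m} hχ.kernel),
    ← integral_const_mul]
  congr 1 with x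
  rw [smul_apply, norm_smul, Complex.norm_real, Real.norm_of_nonneg (by positivity)]

lemma IsLPBump.integral_norm_lineDeriv_lineDeriv_dyadicKernel (hχ : IsLPBump χ) (m m' : Rn n)
    (j : ℕ) : ∫ x, ‖∂_{m'} (∂_{m} (hχ.dyadicKernel j)) x‖ =
      (2 : ℝ) ^ j * ((2 : ℝ) ^ j * ∫ x, ‖∂_{m'} (∂_{m} hχ.kernel) x‖) := by
  rw [hχ.lineDeriv_dyadicKernel, LineDeriv.lineDerivOp_smul, lineDeriv_schwartzDil,
    ← integral_norm_schwartzDil (N := (2 : ℝ) ^ j) (by positivity) (∂_{m'} (∂_{m} hχ.kernel)),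
    ← integral_const_mul, ← integral_const_mul]
  congr 1 with x
  rw [smul_apply, norm_smul, smul_apply, norm_smul, Complex.norm_real,
    Real.norm_of_nonneg (by positivity)]

lemma IsLPBump.norm_schwartzConv_dyadicKernel_sub_le (hχ : IsLPBump χ) {f : Rn n → ℂ} {L : ℝ≥0}
    (hf : LipschitzWith L f) (hfi : Integrable f) (J : ℕ) (x : Rn n) :
    ‖schwartzConv f (hχ.dyadicKernel J) x - f x‖ ≤
      L * (∫ y, ‖y‖ * ‖hχ.kernel y‖) * ((2 : ℝ) ^ J)⁻¹ :=
  norm_schwartzConv_dil_sub_le (by positivity) hχ.integral_kernel hf hfi x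

/-- The derivatives of the low-frequency parts converge in the sense of distributions. -/
lemma IsLPBump.tendsto_integral_smul_lineDeriv (hχ : IsLPBump χ) {f : Rn n → ℂ} {L : ℝ≥0}
    (hf : LipschitzWith L f) (hfi : Integrable f) {g : Rn n → ℂ} {m : Rn n}
    (hfg : ∀ φ : Rn n → ℂ, ContDiff ℝ ∞ φ →
      ∫ t, f t * fderiv ℝ φ t m = -∫ t, g t * φ t)
    {φ : Rn n → ℝ} (hφ : ContDiff ℝ ∞ φ) (hφc : HasCompactSupport φ) :
    Tendsto (fun J => ∫ x, φ x • schwartzConv f (∂_{m} (hχ.dyadicKernel J)) x) atTop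
      (𝓝 (∫ x, φ x • g x)) := by
  have hφd : Continuous fun x => fderiv ℝ φ x m :=
    (hφ.continuous_fderiv (by norm_num)).clm_apply continuous_const
  have hφdc : HasCompactSupport fun x => fderiv ℝ φ x m := hφc.fderiv_apply ℝ _
  have h1 : ∫ x, φ x • g x = -∫ x, fderiv ℝ φ x m • f x := by
    have h := hfg (fun x => (φ x : ℂ)) (Complex.ofRealCLM.contDiff.comp hφ)
    have hd : ∀ x, fderiv ℝ (fun x => (φ x : ℂ)) x m = (fderiv ℝ φ x m : ℂ) := fun x => by
      have h : HasFDerivAt (fun x => (φ x : ℂ)) (Complex.ofRealCLM.comp (fderiv ℝ φ x)) x :=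
        Complex.ofRealCLM.hasFDerivAt.comp x
          (hφ.differentiable (by norm_num)).differentiableAt.hasFDerivAt
      rw [h.fderiv]
      rfl
    simp_rw [hd] at h
    have e1 : ∫ x, φ x • g x = ∫ t, g t * (φ t : ℂ) := by
      congr 1 with x; rw [Complex.real_smul, mul_comm]
    have e2 : ∫ x, fderiv ℝ φ x m • f x = ∫ t, f t * (fderiv ℝ φ t m : ℂ) := by
      congr 1 with x; rw [Complex.real_smul, mul_comm]
    rw [e1, e2, h, neg_neg]
  -- Moving the derivative onto `φ` leaves the undifferentiated low-frequency parts, which converge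
  -- uniformly by the Lipschitz bound.
  have h2 : ∀ J, ∫ x, φ x • schwartzConv f (∂_{m} (hχ.dyadicKernel J)) x =
      -∫ x, fderiv ℝ φ x m • schwartzConv f (hχ.dyadicKernel J) x := by
    intro J
    have hc : ∀ ρ, Continuous (schwartzConv f ρ) := fun ρ =>
      (contDiff_schwartzConv hfi 0 ρ).continuous
    simp_rw [← fderiv_schwartzConv_apply hfi]
    refine integral_smul_fderiv_eq_neg_fderiv_smul_of_integrable ?_ ?_ ?_
      (fun x _ => (hφ.differentiable (by norm_num)).differentiableAt)
      (fun x _ => (hasFDerivAt_schwartzConv hfi _ x).differentiableAt)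
    · exact (hφd.smul (hc _)).integrable_of_hasCompactSupport hφdc.smul_right
    · simp_rw [fderiv_schwartzConv_apply hfi]
      exact (hφ.continuous.smul (hc _)).integrable_of_hasCompactSupport hφc.smul_right
    · exact (hφ.continuous.smul (hc _)).integrable_of_hasCompactSupport hφc.smul_right
  simp_rw [h1, h2]
  refine Tendsto.neg ?_
  set c : ℝ := L * (∫ y, ‖y‖ * ‖hχ.kernel y‖) with hc
  have hc0 : 0 ≤ c := mul_nonneg L.2 (integral_nonneg fun y => by positivity)
  refine tendsto_integral_of_dominated_convergence
    (fun x => ‖fderiv ℝ φ x m‖ * (‖f x‖ + c)) (fun J => ?_) ?_ (fun J => ?_) ?_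
  · exact (hφd.smul (contDiff_schwartzConv hfi 0 _).continuous).aestronglyMeasurable
  · exact (hφd.norm.mul (hf.continuous.norm.add continuous_const)).integrable_of_hasCompactSupport
      hφdc.norm.mul_right
  · refine Eventually.of_forall fun x => ?_
    rw [norm_smul]
    gcongr
    have h3 := hχ.norm_schwartzConv_dyadicKernel_sub_le hf hfi J x
    have h4 : c * ((2 : ℝ) ^ J)⁻¹ ≤ c :=
      mul_le_of_le_one_right hc0 (inv_le_one_of_one_le₀ (one_le_pow₀ (by norm_num)))
    have h5 := norm_le_insert' (schwartzConv f (hχ.dyadicKernel J) x) (f x)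
    linarith
  · refine Eventually.of_forall fun x => Tendsto.const_smul ?_ _
    rw [tendsto_iff_norm_sub_tendsto_zero]
    refine squeeze_zero (fun J => norm_nonneg _)
      (fun J => hχ.norm_schwartzConv_dyadicKernel_sub_le hf hfi J x) ?_
    have := tendsto_pow_atTop_nhds_zero_of_lt_one (r := (2 : ℝ)⁻¹) (by norm_num) (by norm_num)
    simpa using this.const_mul c

/-- Bernstein's inequality: the derivative falls on the reproducing kernel at frequency `2^{i+2} = 2
· 2^{i+1}`, which accounts for the factor `2`. With two derivatives it becomes `4`. -/
lemma IsLPBump.integral_norm_lineDeriv_increment_le (hχ : IsLPBump χ) {f : Rn n → ℂ}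
    (hf : Integrable f) {s S : ℝ} {i : ℕ}
    (hS : ∫ x, ‖schwartzConv f (hχ.dyadicKernel (i + 1) - hχ.dyadicKernel i) x‖ ≤
      S * ((2 : ℝ) ^ (i + 1)) ^ (-(1 + s))) (m : Rn n) :
    ∫ x, ‖schwartzConv f (∂_{m} (hχ.dyadicKernel (i + 1))) x -
      schwartzConv f (∂_{m} (hχ.dyadicKernel i)) x‖ ≤
      2 * S * (∫ x, ‖∂_{m} hχ.kernel x‖) * ((2 : ℝ) ^ (-s)) ^ (i + 1) := by
  have hsub : ∂_{m} (hχ.dyadicKernel (i + 1)) - ∂_{m} (hχ.dyadicKernel i) =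
      ∂_{m} (hχ.dyadicKernel (i + 1) - hχ.dyadicKernel i) := by
    simpa using (map_sub (LineDeriv.lineDerivOpCLM ℂ 𝓢(Rn n, ℂ) m) (hχ.dyadicKernel (i + 1))
      (hχ.dyadicKernel i)).symm
  have hpi := integrable_schwartzConv hf (hχ.dyadicKernel (i + 1) - hχ.dyadicKernel i)
  have hc : 0 ≤ ∫ x, ‖∂_{m} hχ.kernel x‖ := integral_nonneg fun x => norm_nonneg _
  simp_rw [← schwartzConv_sub_right hf, hsub]
  rw [schwartzConv_lineDeriv_congr hf hpi (hχ.schwartzConv_dyadic_piece hf i)]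
  refine (integral_norm_schwartzConv_le hpi _).trans ?_
  rw [hχ.integral_norm_lineDeriv_dyadicKernel]
  refine (mul_le_mul_of_nonneg_right hS (by positivity)).trans_eq ?_
  rw [← two_pow_rpow, show -s = -(1 + s) + 1 by ring, Real.rpow_add_one (by positivity)]
  ring

lemma IsLPBump.integral_norm_lineDeriv_lineDeriv_increment_le (hχ : IsLPBump χ) {f : Rn n → ℂ}
    (hf : Integrable f) {s S : ℝ} {i : ℕ}
    (hS : ∫ x, ‖schwartzConv f (hχ.dyadicKernel (i + 1) - hχ.dyadicKernel i) x‖ ≤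
      S * ((2 : ℝ) ^ (i + 1)) ^ (-(1 + s))) (m m' : Rn n) :
    ∫ x, ‖schwartzConv f (∂_{m'} (∂_{m} (hχ.dyadicKernel (i + 1)))) x -
      schwartzConv f (∂_{m'} (∂_{m} (hχ.dyadicKernel i))) x‖ ≤
      4 * S * (∫ x, ‖∂_{m'} (∂_{m} hχ.kernel) x‖) * ((2 : ℝ) ^ (1 - s)) ^ (i + 1) := by
  have hsub : ∂_{m'} (∂_{m} (hχ.dyadicKernel (i + 1))) - ∂_{m'} (∂_{m} (hχ.dyadicKernel i)) =
      ∂_{m'} (∂_{m} (hχ.dyadicKernel (i + 1) - hχ.dyadicKernel i)) := by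
    simpa using (map_sub (LineDeriv.lineDerivOpCLM ℂ 𝓢(Rn n, ℂ) m' ∘L
      LineDeriv.lineDerivOpCLM ℂ 𝓢(Rn n, ℂ) m) (hχ.dyadicKernel (i + 1))
      (hχ.dyadicKernel i)).symm
  have hpi := integrable_schwartzConv hf (hχ.dyadicKernel (i + 1) - hχ.dyadicKernel i)
  have hc : 0 ≤ ∫ x, ‖∂_{m'} (∂_{m} hχ.kernel) x‖ := integral_nonneg fun x => norm_nonneg _
  simp_rw [← schwartzConv_sub_right hf, hsub]
  rw [schwartzConv_lineDeriv_congr hf hpi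
    (schwartzConv_lineDeriv_congr hf hpi (hχ.schwartzConv_dyadic_piece hf i) m)]
  refine (integral_norm_schwartzConv_le hpi _).trans ?_
  rw [hχ.integral_norm_lineDeriv_lineDeriv_dyadicKernel]
  refine (mul_le_mul_of_nonneg_right hS (by positivity)).trans_eq ?_
  rw [← two_pow_rpow, show 1 - s = -(1 + s) + 1 + 1 by ring, Real.rpow_add_one (by positivity),
    Real.rpow_add_one (by positivity)]
  ring

/-- The gradient of the low-frequency part is close to the weak gradient in `L¹`. -/
lemma IsLPBump.integral_norm_lineDeriv_sub_le (hχ : IsLPBump χ) {f g : Rn n → ℂ} {L : ℝ≥0}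
    (hL : LipschitzWith L f) (hf : Integrable f) (hg : Integrable g) {m : Rn n}
    (hfg : ∀ φ : Rn n → ℂ, ContDiff ℝ ∞ φ → ∫ t, f t * fderiv ℝ φ t m = -∫ t, g t * φ t)
    {s S : ℝ} (hs : 0 < s) (hS0 : 0 ≤ S)
    (hS : ∀ i : ℕ, ∫ x, ‖schwartzConv f (hχ.dyadicKernel (i + 1) - hχ.dyadicKernel i) x‖ ≤
      S * ((2 : ℝ) ^ (i + 1)) ^ (-(1 + s))) (J : ℕ) :
    ∫ x, ‖schwartzConv f (∂_{m} (hχ.dyadicKernel J)) x - g x‖ ≤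
      2 * S * (∫ x, ‖∂_{m} hχ.kernel x‖) / (1 - (2 : ℝ) ^ (-s)) * ((2 : ℝ) ^ J) ^ (-s) := by
  set q : ℝ := (2 : ℝ) ^ (-s) with hq
  have hq0 : 0 < q := by positivity
  have hq1 : q < 1 := Real.rpow_lt_one_of_one_lt_of_neg (by norm_num) (by linarith)
  set c : ℝ := 2 * S * (∫ x, ‖∂_{m} hχ.kernel x‖) with hc
  have hc0 : 0 ≤ c := mul_nonneg (by positivity) (integral_nonneg fun x => norm_nonneg _)
  have htail : HasSum (fun i => c * q ^ (J + i + 1)) (c * q ^ (J + 1) * (1 - q)⁻¹) := by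
    have h := (hasSum_geometric_of_lt_one hq0.le hq1).mul_left (c * q ^ (J + 1))
    have e : (fun i => c * q ^ (J + i + 1)) = fun i => c * q ^ (J + 1) * q ^ i := by
      funext i; ring
    rwa [e]
  -- The sequence is started at `J`, so that only the tail of the geometric series remains.
  have h1 := integral_norm_sub_le_tsum
    (D := fun i => schwartzConv f (∂_{m} (hχ.dyadicKernel (J + i)))) (g := g)
    (fun i => integrable_schwartzConv hf _) hg
    (fun φ hφ hφc => (hχ.tendsto_integral_smul_lineDeriv hL hf hfg hφ hφc).comp
      (tendsto_atTop_mono (fun i => Nat.le_add_left i J) tendsto_id))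
    htail.summable (fun i => hχ.integral_norm_lineDeriv_increment_le hf (hS (J + i)) m)
  rw [htail.tsum_eq] at h1
  refine h1.trans ?_
  rw [two_pow_rpow, pow_succ, ← hq]
  have h1q : 0 < 1 - q := by linarith
  calc c * (q ^ J * q) * (1 - q)⁻¹ = c / (1 - q) * q ^ J * q := by ring
    _ ≤ c / (1 - q) * q ^ J := mul_le_of_le_one_right (by positivity) hq1.le

/-- The second derivatives of the low-frequency part are controlled in `L¹`. -/
lemma IsLPBump.integral_norm_lineDeriv_lineDeriv_le (hχ : IsLPBump χ) {f : Rn n → ℂ}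
    (hf : Integrable f) {s S : ℝ} (hs : s < 1) (hS0 : 0 ≤ S)
    (hS : ∀ i : ℕ, ∫ x, ‖schwartzConv f (hχ.dyadicKernel (i + 1) - hχ.dyadicKernel i) x‖ ≤
      S * ((2 : ℝ) ^ (i + 1)) ^ (-(1 + s))) (m m' : Rn n) (J : ℕ) :
    ∫ x, ‖schwartzConv f (∂_{m'} (∂_{m} (hχ.dyadicKernel J))) x‖ ≤
      ((∫ x, ‖schwartzConv f (∂_{m'} (∂_{m} (hχ.dyadicKernel 0))) x‖) +
        4 * S * (∫ x, ‖∂_{m'} (∂_{m} hχ.kernel) x‖) * (2 : ℝ) ^ (1 - s) /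
          ((2 : ℝ) ^ (1 - s) - 1)) * ((2 : ℝ) ^ J) ^ (1 - s) := by
  set p : ℝ := (2 : ℝ) ^ (1 - s) with hp
  have hp1 : 1 < p := Real.one_lt_rpow (by norm_num) (by linarith)
  set c : ℝ := 4 * S * (∫ x, ‖∂_{m'} (∂_{m} hχ.kernel) x‖) with hc
  have hc0 : 0 ≤ c := mul_nonneg (by positivity) (integral_nonneg fun x => norm_nonneg _)
  set d : ℝ := ∫ x, ‖schwartzConv f (∂_{m'} (∂_{m} (hχ.dyadicKernel 0))) x‖ with hd
  have hd0 : 0 ≤ d := integral_nonneg fun x => norm_nonneg _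
  have hi := fun J => integrable_schwartzConv hf (∂_{m'} (∂_{m} (hχ.dyadicKernel J)))
  -- The increments are at most `c p^{J+1}`, and the coefficient `c p / (p - 1)` is the one for
  -- which the induction closes exactly. The term `d` is the contribution of the lowest frequencies.
  have hind : ∀ J : ℕ, ∫ x, ‖schwartzConv f (∂_{m'} (∂_{m} (hχ.dyadicKernel J))) x‖ ≤
      d + c * p / (p - 1) * (p ^ J - 1) := by
    intro J
    induction J with
    | zero => simp [hd]
    | succ J ih =>
      calc ∫ x, ‖schwartzConv f (∂_{m'} (∂_{m} (hχ.dyadicKernel (J + 1)))) x‖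
          ≤ ∫ x, (‖schwartzConv f (∂_{m'} (∂_{m} (hχ.dyadicKernel J))) x‖ +
              ‖schwartzConv f (∂_{m'} (∂_{m} (hχ.dyadicKernel (J + 1)))) x -
                schwartzConv f (∂_{m'} (∂_{m} (hχ.dyadicKernel J))) x‖) :=
            integral_mono (hi _).norm ((hi _).norm.add ((hi _).sub (hi _)).norm)
              fun x => norm_le_insert' _ _
        _ ≤ (d + c * p / (p - 1) * (p ^ J - 1)) + c * p ^ (J + 1) := by
            refine (integral_add (hi _).norm ((hi _).sub (hi _)).norm).trans_le ?_
            exact add_le_add ih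
              (hχ.integral_norm_lineDeriv_lineDeriv_increment_le hf (hS J) m m')
        _ = d + c * p / (p - 1) * (p ^ (J + 1) - 1) := by
            have : p - 1 ≠ 0 := by linarith
            field_simp
            ring
  refine (hind J).trans ?_
  rw [two_pow_rpow, ← hp, add_mul]
  have hpJ : 1 ≤ p ^ J := one_le_pow₀ hp1.le
  have hp0 : 0 < p - 1 := by linarith
  gcongr
  · exact le_mul_of_one_le_right hd0 hpJ
  · linarith

lemma exists_nonneg_forall_le_of_finite {ι : Type*} [Finite ι] (a : ι → ℝ) :
    ∃ c, 0 ≤ c ∧ ∀ i, a i ≤ c := by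
  obtain ⟨c, hc⟩ := (Set.finite_range a).bddAbove
  exact ⟨max c 0, le_max_right _ _, fun i => (hc ⟨i, rfl⟩).trans (le_max_left _ _)⟩

/-- Quantitative approximation of a Lipschitz function, whose dyadic pieces decay like
`2 ^ (-j (1 + s))` in `L¹`, by its low-frequency parts. -/
lemma IsLPBump.exists_smooth_approx (hχ : IsLPBump χ) {f : Rn n → ℝ} {g : Fin n → Rn n → ℝ}
    (hf : Integrable f) {L : ℝ≥0} (hL : LipschitzWith L f) (hg : ∀ j, Integrable (g j))
    {B : ℝ} (hB : ∀ j, ∀ᵐ x, |g j x| ≤ B)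
    (hfg : ∀ j, ∀ φ : Rn n → ℂ, ContDiff ℝ ∞ φ →
      ∫ t, (f t : ℂ) * fderiv ℝ φ t (EuclideanSpace.single j 1) = -∫ t, (g j t : ℂ) * φ t)
    {s S : ℝ} (hs : s ∈ Set.Ioo (0 : ℝ) 1) (hS0 : 0 ≤ S)
    (hS : ∀ j : ℕ, ∫ x, ‖schwartzConv (fun x => (f x : ℂ))
      (hχ.dyadicKernel (j + 1) - hχ.dyadicKernel j) x‖ ≤ S * ((2 : ℝ) ^ (j + 1)) ^ (-(1 + s))) :
    ∃ C : ℝ, 0 ≤ C ∧ ∀ J : ℕ, ∃ w : Rn n → ℝ, ContDiff ℝ 2 w ∧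
      (∀ x, |w x - f x| ≤ C * ((2 : ℝ) ^ J)⁻¹) ∧
      (∀ j x, |partialDeriv j w x| ≤ C) ∧
      (∀ j, Integrable (partialDeriv j w)) ∧
      (∀ j, ∫ x, |partialDeriv j w x - g j x| ≤ C * ((2 : ℝ) ^ J) ^ (-s)) ∧
      (∀ j k, Integrable (partialDeriv k (partialDeriv j w))) ∧
      (∀ j k, ∫ x, |partialDeriv k (partialDeriv j w) x| ≤ C * ((2 : ℝ) ^ J) ^ (1 - s)) := by
  set fc : Rn n → ℂ := fun x => (f x : ℂ) with hfc
  have hfci : Integrable fc := hf.ofReal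
  have hLc : LipschitzWith L fc := by
    have h := Complex.isometry_ofReal.lipschitz.comp hL
    rwa [one_mul] at h
  set c0 : ℝ := L * (∫ y, ‖y‖ * ‖hχ.kernel y‖)
  set cB : ℝ := B * ∫ y, ‖hχ.kernel y‖
  obtain ⟨K1, hK10, hK1⟩ : ∃ c, 0 ≤ c ∧ ∀ j : Fin n,
      2 * S * (∫ x, ‖∂_{EuclideanSpace.single j (1 : ℝ)} hχ.kernel x‖) / (1 - (2 : ℝ) ^ (-s)) ≤ c :=
    exists_nonneg_forall_le_of_finite _
  obtain ⟨K2, hK20, hK2⟩ : ∃ c, 0 ≤ c ∧ ∀ p : Fin n × Fin n,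
      (∫ x, ‖schwartzConv fc (∂_{EuclideanSpace.single p.2 (1 : ℝ)}
        (∂_{EuclideanSpace.single p.1 (1 : ℝ)} (hχ.dyadicKernel 0))) x‖) +
      4 * S * (∫ x, ‖∂_{EuclideanSpace.single p.2 (1 : ℝ)}
        (∂_{EuclideanSpace.single p.1 (1 : ℝ)} hχ.kernel) x‖) * (2 : ℝ) ^ (1 - s) /
          ((2 : ℝ) ^ (1 - s) - 1) ≤ c :=
    exists_nonneg_forall_le_of_finite _
  refine ⟨|c0| + |cB| + K1 + K2, by positivity, fun J => ?_⟩
  -- Since `f` and `g` are real, passing to real parts only decreases the errors.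
  refine ⟨fun x => (schwartzConv fc (hχ.dyadicKernel J) x).re, ?_, fun x => ?_, fun j x => ?_, fun j => ?_,
    fun j => ?_, fun j k => ?_, fun j k => ?_⟩
  · exact Complex.reCLM.contDiff.comp (contDiff_schwartzConv hfci 2 (hχ.dyadicKernel J))
  · have h1 := hχ.norm_schwartzConv_dyadicKernel_sub_le hLc hfci J x
    have h2 := Complex.abs_re_le_norm (schwartzConv fc (hχ.dyadicKernel J) x - fc x)
    rw [Complex.sub_re] at h2
    refine (h2.trans h1).trans (mul_le_mul_of_nonneg_right ?_ (by positivity))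
    linarith [le_abs_self c0, abs_nonneg cB]
  · rw [partialDeriv_re_schwartzConv hfci, schwartzConv_lineDeriv_of_weakDeriv (hfg j)]
    refine (Complex.abs_re_le_norm _).trans ((norm_schwartzConv_le (B := B) ?_ _ x).trans ?_)
    · filter_upwards [hB j] with t ht
      rwa [Complex.norm_real]
    · have : ∫ t, ‖hχ.dyadicKernel J t‖ = ∫ t, ‖hχ.kernel t‖ := integral_norm_schwartzDil (by positivity) _
      rw [this]
      linarith [le_abs_self cB, abs_nonneg c0]
  · rw [partialDeriv_re_schwartzConv hfci]
    exact (integrable_schwartzConv hfci _).re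
  · rw [partialDeriv_re_schwartzConv hfci]
    have hgi : Integrable fun x => (g j x : ℂ) := (hg j).ofReal
    have h1 := hχ.integral_norm_lineDeriv_sub_le hLc hfci hgi (hfg j) hs.1 hS0 hS J
    have h2 : ∫ x, |(schwartzConv fc (∂_{EuclideanSpace.single j (1 : ℝ)} (hχ.dyadicKernel J)) x).re - g j x| ≤
        ∫ x, ‖schwartzConv fc (∂_{EuclideanSpace.single j (1 : ℝ)} (hχ.dyadicKernel J)) x - (g j x : ℂ)‖ := by
      refine integral_mono (((integrable_schwartzConv hfci _).re.sub (hg j)).abs)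
        ((integrable_schwartzConv hfci _).sub hgi).norm fun x => ?_
      simpa using Complex.abs_re_le_norm (schwartzConv fc (∂_{EuclideanSpace.single j (1 : ℝ)} (hχ.dyadicKernel J)) x - (g j x : ℂ))
    refine (h2.trans h1).trans ?_
    refine mul_le_mul_of_nonneg_right ?_ (by positivity)
    linarith [hK1 j, abs_nonneg c0, abs_nonneg cB]
  · rw [partialDeriv_re_schwartzConv hfci, partialDeriv_re_schwartzConv hfci]
    exact (integrable_schwartzConv hfci _).re
  · rw [partialDeriv_re_schwartzConv hfci, partialDeriv_re_schwartzConv hfci]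
    have hi := fun J => integrable_schwartzConv hfci (∂_{EuclideanSpace.single k (1 : ℝ)} (∂_{EuclideanSpace.single j (1 : ℝ)} (hχ.dyadicKernel J)))
    have h1 := hχ.integral_norm_lineDeriv_lineDeriv_le hfci hs.2 hS0 hS (EuclideanSpace.single j (1 : ℝ))
      (EuclideanSpace.single k (1 : ℝ)) J
    have h2 : ∫ x, |(schwartzConv fc (∂_{EuclideanSpace.single k (1 : ℝ)} (∂_{EuclideanSpace.single j (1 : ℝ)} (hχ.dyadicKernel J))) x).re| ≤
        ∫ x, ‖schwartzConv fc (∂_{EuclideanSpace.single k (1 : ℝ)} (∂_{EuclideanSpace.single j (1 : ℝ)} (hχ.dyadicKernel J))) x‖ :=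
      integral_mono (hi J).re.abs (hi J).norm fun x => Complex.abs_re_le_norm _
    refine (h2.trans h1).trans ?_
    refine mul_le_mul_of_nonneg_right ?_ (by positivity)
    linarith [hK2 (j, k), abs_nonneg c0, abs_nonneg cB]

end SmoothApproximation

/-! ### Cutoff functions at the boundary. -/

section Cutoff

variable {n : ℕ}

lemma partialDeriv_mul {f g : Rn n → ℝ} (hf : Differentiable ℝ f) (hg : Differentiable ℝ g)
    (j : Fin n) : partialDeriv j (fun x => f x * g x) =
      fun x => partialDeriv j f x * g x + f x * partialDeriv j g x := by
  funext x
  have h : HasFDerivAt (fun x => f x * g x) _ x := (hf x).hasFDerivAt.mul (hg x).hasFDerivAt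
  rw [partialDeriv, h.fderiv]
  simp [partialDeriv]
  ring

lemma partialDeriv_add {f g : Rn n → ℝ} (hf : Differentiable ℝ f) (hg : Differentiable ℝ g)
    (j : Fin n) : partialDeriv j (fun x => f x + g x) =
      fun x => partialDeriv j f x + partialDeriv j g x := by
  funext x
  have h : HasFDerivAt (fun x => f x + g x) _ x := (hf x).hasFDerivAt.add (hg x).hasFDerivAt
  rw [partialDeriv, h.fderiv]
  simp [partialDeriv]

/-- Stated for germs rather than values so that it can be applied twice for second derivatives. -/
lemma partialDeriv_congr {f g : Rn n → ℝ} {x : Rn n} (h : f =ᶠ[nhds x] g) (j : Fin n) :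
    partialDeriv j f =ᶠ[nhds x] partialDeriv j g := by
  filter_upwards [h.eventuallyEq_nhds] with y hy
  rw [partialDeriv, partialDeriv, hy.fderiv_eq]

lemma contDiff_partialDeriv {f : Rn n → ℝ} (hf : ContDiff ℝ 2 f) (j : Fin n) :
    ContDiff ℝ 1 (partialDeriv j f) :=
  (hf.fderiv_right (m := 1) (by norm_num)).clm_apply contDiff_const

/-- A cutoff function vanishing near `D`, equal to one away from `D`, with the transition at scale
`ε` and derivatives bounded accordingly. -/
lemma exists_cutoff (n : ℕ) : ∃ C : ℝ, 0 ≤ C ∧ ∀ D : Set (Rn n), Bornology.IsBounded Dᶜ →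
    ∀ ε : ℝ, 0 < ε → ∃ η : Rn n → ℝ, ContDiff ℝ 2 η ∧ (∀ x, |η x| ≤ C) ∧
      (∀ j x, |partialDeriv j η x| ≤ C * ε⁻¹) ∧
      (∀ j k x, |partialDeriv k (partialDeriv j η) x| ≤ C * (ε⁻¹ * ε⁻¹)) ∧
      (∀ x ∈ Metric.thickening ε D, η x = 0) ∧
      (∀ x ∉ Metric.thickening (3 * ε) D, η x = 1) := by
  let φ : ContDiffBump (0 : Rn n) := ⟨1 / 2, 1, by norm_num, by norm_num⟩
  have hc : HasCompactSupport (Complex.ofRealCLM ∘ φ.normed volume) :=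
    φ.hasCompactSupport_normed.comp_left rfl
  have hs : ContDiff ℝ ∞ (Complex.ofRealCLM ∘ φ.normed volume) :=
    Complex.ofRealCLM.contDiff.comp φ.contDiff_normed
  set ρ : 𝓢(Rn n, ℂ) := hc.toSchwartzMap hs with hρ
  have hρa : ∀ x, ρ x = (φ.normed volume x : ℂ) := fun x => rfl
  have hρs : ∀ x, ρ x ≠ 0 → ‖x‖ < 1 := fun x hx => by
    have h1 : x ∈ Function.support (φ.normed volume) := fun h => hx (by rw [hρa, h]; simp)
    rw [φ.support_normed_eq, mem_ball_zero_iff] at h1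
    exact h1
  have hρi : ∫ x, ρ x = 1 := by
    simp_rw [hρa]
    rw [integral_complex_ofReal, φ.integral_normed, Complex.ofReal_one]
  obtain ⟨K1, hK10, hK1⟩ := exists_nonneg_forall_le_of_finite fun j : Fin n =>
    ∫ x, ‖∂_{EuclideanSpace.single j (1 : ℝ)} ρ x‖
  obtain ⟨K2, hK20, hK2⟩ := exists_nonneg_forall_le_of_finite fun p : Fin n × Fin n =>
    ∫ x, ‖∂_{EuclideanSpace.single p.2 (1 : ℝ)} (∂_{EuclideanSpace.single p.1 (1 : ℝ)} ρ) x‖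
  set K0 : ℝ := ∫ x, ‖ρ x‖ with hK0
  have hK00 : 0 ≤ K0 := integral_nonneg fun x => norm_nonneg _
  refine ⟨K0 + K1 + K2, by positivity, fun D hD ε hε => ?_⟩
  have hε' : 0 < ε⁻¹ := inv_pos.2 hε
  -- The indicator jumps at distance `2ε` and is mollified by a kernel supported within `ε`, so the
  -- transition happens between `ε` and `3ε`.
  set A : Set (Rn n) := (Metric.thickening (2 * ε) D)ᶜ with hA
  have hAm : MeasurableSet A := Metric.isOpen_thickening.measurableSet.compl
  have hAb : Bornology.IsBounded A :=
    hD.subset (compl_subset_compl.2 (Metric.self_subset_thickening (by positivity) D))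
  set f : Rn n → ℂ := A.indicator fun _ => 1 with hf
  have hfi : Integrable f := (integrable_indicator_iff hAm).2
    (integrableOn_const hAb.measure_lt_top.ne)
  have hfb : ∀ᵐ t, ‖f t‖ ≤ 1 := Filter.Eventually.of_forall fun t => by
    by_cases h : t ∈ A <;> simp [hf, h]
  set κ := schwartzDil ε⁻¹ hε'.ne' ρ with hκ
  have hκs : ∀ x, κ x ≠ 0 → ‖x‖ < ε := fun x hx => by
    rw [hκ, schwartzDil_apply] at hx
    have := hρs _ (right_ne_zero_of_mul hx)
    rwa [norm_smul, Real.norm_of_nonneg hε'.le, inv_mul_lt_iff₀ hε, mul_one] at this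
  have hκi : ∀ x, ∫ t, κ (x - t) = 1 := fun x => by
    rw [integral_sub_left_eq_self (fun t => κ t) volume x, ← hρi,
      ← integral_comp_smul_Rn hε' (fun x => ρ x)]
    congr 1 with y
    simp [hκ, schwartzDil_apply]
  refine ⟨fun x => (schwartzConv f κ x).re, ?_, fun x => ?_, fun j x => ?_, fun j k x => ?_,
    fun x hx => ?_, fun x hx => ?_⟩
  · exact Complex.reCLM.contDiff.comp (contDiff_schwartzConv hfi 2 κ)
  · refine (Complex.abs_re_le_norm _).trans ((norm_schwartzConv_le hfb κ x).trans ?_)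
    rw [hκ, integral_norm_schwartzDil hε']
    linarith
  · rw [partialDeriv_re_schwartzConv hfi, hκ, lineDeriv_schwartzDil]
    beta_reduce
    rw [schwartzConv_smul_right]
    refine (Complex.abs_re_le_norm _).trans ?_
    rw [norm_mul, Complex.norm_real, Real.norm_of_nonneg hε'.le, mul_comm]
    refine mul_le_mul_of_nonneg_right ((norm_schwartzConv_le hfb _ x).trans ?_) hε'.le
    rw [integral_norm_schwartzDil hε']
    linarith [hK1 j]
  · rw [partialDeriv_re_schwartzConv hfi, partialDeriv_re_schwartzConv hfi, hκ,
      lineDeriv_schwartzDil, LineDeriv.lineDerivOp_smul, lineDeriv_schwartzDil]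
    beta_reduce
    rw [schwartzConv_smul_right, schwartzConv_smul_right]
    refine (Complex.abs_re_le_norm _).trans ?_
    rw [norm_mul, norm_mul, Complex.norm_real, Real.norm_of_nonneg hε'.le, ← mul_assoc, mul_comm]
    refine mul_le_mul_of_nonneg_right ((norm_schwartzConv_le hfb _ x).trans ?_) (by positivity)
    rw [integral_norm_schwartzDil hε']
    linarith [hK2 (j, k)]
  · have h0 : schwartzConv f κ x = 0 := by
      rw [schwartzConv, ← integral_zero (Rn n) ℂ]
      congr 1 with t
      by_contra h
      have h1 := hκs _ (right_ne_zero_of_mul h)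
      have h2 : t ∈ A := by
        by_contra h3
        exact left_ne_zero_of_mul h (by simp [hf, h3])
      obtain ⟨z, hz, hxz⟩ := Metric.mem_thickening_iff.1 hx
      refine h2 (Metric.mem_thickening_iff.2 ⟨z, hz, ?_⟩)
      have h4 := dist_triangle t x z
      rw [dist_comm t x, dist_eq_norm x t] at h4
      linarith
    simp [h0]
  · have h0 : schwartzConv f κ x = 1 := by
      rw [schwartzConv, ← hκi x]
      congr 1 with t
      by_cases h : κ (x - t) = 0
      · simp [h]
      · have h1 := hκs _ h
        have h2 : t ∈ A := by
          intro h3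
          obtain ⟨z, hz, htz⟩ := Metric.mem_thickening_iff.1 h3
          refine hx (Metric.mem_thickening_iff.2 ⟨z, hz, ?_⟩)
          have h4 := dist_triangle x t z
          rw [dist_eq_norm x t] at h4
          linarith
        simp [hf, h2]
    simp [h0]

end Cutoff

/-! ### Cutting off the approximations. -/

section Competitor

variable {n : ℕ}

lemma integrableOn_of_continuous_of_isBounded {f : Rn n → ℝ} (hf : Continuous f) {Ω : Set (Rn n)}
    (hΩ : Bornology.IsBounded Ω) : IntegrableOn f Ω :=
  (hf.continuousOn.integrableOn_compact hΩ.isCompact_closure).mono_set subset_closure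

/-- Cutting off the smooth approximations near the boundary preserves their estimates up to the
measure of the boundary layer. -/
lemma exists_cutoff_approx {Ω : Set (Rn n)} (hΩo : IsOpen Ω) (hΩb : Bornology.IsBounded Ω)
    {Cl : ℝ} (hCl0 : 0 ≤ Cl) (hCl : ∀ δ ∈ Set.Ioc (0 : ℝ) 1,
      volume (Ω ∩ Metric.thickening δ Ωᶜ) ≤ ENNReal.ofReal (Cl * δ))
    {f : Rn n → ℝ} {L : ℝ≥0} (hL : LipschitzWith L f) (hfD : ∀ x ∈ (closure Ω)ᶜ, f x = 0)
    {g : Fin n → Rn n → ℝ} (hg : ∀ j, Integrable (g j)) {B : ℝ} (hB0 : 0 ≤ B)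
    (hB : ∀ j, ∀ᵐ x, |g j x| ≤ B) {s : ℝ} (hs : s ∈ Set.Ioo (0 : ℝ) 1) {Cw : ℝ} (hCw : 0 ≤ Cw)
    (happ : ∀ J : ℕ, ∃ w : Rn n → ℝ, ContDiff ℝ 2 w ∧
      (∀ x, |w x - f x| ≤ Cw * ((2 : ℝ) ^ J)⁻¹) ∧
      (∀ j x, |partialDeriv j w x| ≤ Cw) ∧
      (∀ j, Integrable (partialDeriv j w)) ∧
      (∀ j, ∫ x, |partialDeriv j w x - g j x| ≤ Cw * ((2 : ℝ) ^ J) ^ (-s)) ∧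
      (∀ j k, Integrable (partialDeriv k (partialDeriv j w))) ∧
      (∀ j k, ∫ x, |partialDeriv k (partialDeriv j w) x| ≤ Cw * ((2 : ℝ) ^ J) ^ (1 - s))) :
    ∃ C : ℝ, 0 ≤ C ∧ ∀ J : ℕ, 2 ≤ J → ∃ z : Rn n → ℝ, ContDiff ℝ 2 z ∧
      (∀ x ∈ (closure Ω)ᶜ, z x = 0) ∧
      (∀ j, ∀ᵐ x, x ∈ Ω → |partialDeriv j z x - g j x| ≤ C) ∧
      (∀ j, ∫ x in Ω, |partialDeriv j z x - g j x| ≤ C * ((2 : ℝ) ^ J) ^ (-s)) ∧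
      (∀ j k, ∫ x in Ω, |partialDeriv k (partialDeriv j z) x| ≤ C * ((2 : ℝ) ^ J) ^ (1 - s)) := by
  obtain ⟨Cη, hCη, hcut⟩ := exists_cutoff n
  -- In the layer `|w| ≤ c ε`: the error `|w - f|` gives `Cw ε`, and `f` vanishes at some point
  -- within `4ε`, giving `4 L ε`.
  set c : ℝ := Cw + 4 * L with hc
  have hc0 : 0 ≤ c := by positivity
  set C1 : ℝ := Cη * (c + Cw) + B + Cw with hC1
  have hC10 : 0 ≤ C1 := by positivity
  set C2 : ℝ := Cη * (c + 2 * Cw) with hC2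
  have hC20 : 0 ≤ C2 := by positivity
  refine ⟨C1 + (Cw + C1 * (4 * Cl)) + ((1 + Cη) * Cw + C2 * (4 * Cl)), by positivity,
    fun J hJ => ?_⟩
  obtain ⟨w, hw2, hwf, hw1, hw1i, hwg, hw2i, hw2b⟩ := happ J
  set ε : ℝ := ((2 : ℝ) ^ J)⁻¹ with hε
  have hε0 : 0 < ε := by positivity
  -- The layer estimate is used at width `4ε`, which must not exceed one; hence `J ≥ 2`.
  have hε4 : 4 * ε ≤ 1 := by
    rw [hε, ← div_eq_mul_inv, div_le_one (by positivity)]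
    calc (4 : ℝ) = 2 ^ 2 := by norm_num
      _ ≤ 2 ^ J := pow_le_pow_right₀ (by norm_num) hJ
  set D : Set (Rn n) := (closure Ω)ᶜ with hD
  have hDo : IsOpen D := isClosed_closure.isOpen_compl
  obtain ⟨η, hη2, hη0, hη1, hη11, hηD, hηone⟩ := hcut D (by simpa [hD] using hΩb.closure) ε hε0
  -- The closed thickening has open complement, so off `ℓ` the product agrees with `w` near each
  -- point of `Ω` and all derivatives coincide.
  set ℓ : Set (Rn n) := Ω ∩ Metric.cthickening (3 * ε) D with hℓ
  have hℓm : MeasurableSet ℓ := hΩo.measurableSet.inter Metric.isClosed_cthickening.measurableSet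
  have hthick : Metric.cthickening (3 * ε) D ⊆ Metric.thickening (4 * ε) D :=
    Metric.cthickening_subset_thickening' (by positivity) (by linarith) D
  have hℓvol : volume.real ℓ ≤ 4 * Cl * ε := by
    have h1 : volume ℓ ≤ ENNReal.ofReal (Cl * (4 * ε)) := by
      refine (measure_mono ?_).trans (hCl (4 * ε) ⟨by positivity, hε4⟩)
      refine inter_subset_inter_right _ (hthick.trans (Metric.thickening_subset_of_subset _ ?_))
      exact compl_subset_compl.2 subset_closure
    have h2 := ENNReal.toReal_mono ENNReal.ofReal_ne_top h1
    rw [ENNReal.toReal_ofReal (by positivity)] at h2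
    rw [Measure.real]
    linarith
  have hℓi : Integrable (ℓ.indicator fun _ => (1 : ℝ)) :=
    (integrable_indicator_iff hℓm).2
      (integrableOn_const ((hΩb.subset inter_subset_left).measure_lt_top.ne))
  have hℓint : ∫ x, ℓ.indicator (fun _ => (1 : ℝ)) x = volume.real ℓ := by
    rw [integral_indicator hℓm]; simp
  have hwℓ : ∀ x ∈ ℓ, |w x| ≤ c * ε := by
    intro x hx
    obtain ⟨y, hy, hxy⟩ := Metric.mem_thickening_iff.1 (hthick hx.2)
    have h1 := hL.dist_le_mul x y
    rw [hfD y hy, Real.dist_eq, sub_zero] at h1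
    have h2 := hwf x
    have h3 : |w x| ≤ |w x - f x| + |f x| := by
      simpa using abs_add_le (w x - f x) (f x)
    have h4 : (L : ℝ) * dist x y ≤ L * (4 * ε) := by gcongr
    rw [hc]
    linarith
  have hwd : Differentiable ℝ w := hw2.differentiable (by norm_num)
  have hηd : Differentiable ℝ η := hη2.differentiable (by norm_num)
  have hwd1 : ∀ j, Differentiable ℝ (partialDeriv j w) := fun j =>
    (contDiff_partialDeriv hw2 j).differentiable (by norm_num)
  have hηd1 : ∀ j, Differentiable ℝ (partialDeriv j η) := fun j =>
    (contDiff_partialDeriv hη2 j).differentiable (by norm_num)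
  set z : Rn n → ℝ := fun x => η x * w x with hz
  have hz2 : ContDiff ℝ 2 z := hη2.mul hw2
  have hz1 : ∀ j, partialDeriv j z = fun x => partialDeriv j η x * w x + η x * partialDeriv j w x :=
    fun j => partialDeriv_mul hηd hwd j
  have hz11 : ∀ j k, partialDeriv k (partialDeriv j z) = fun x =>
      (partialDeriv k (partialDeriv j η) x * w x + partialDeriv j η x * partialDeriv k w x) +
      (partialDeriv k η x * partialDeriv j w x + η x * partialDeriv k (partialDeriv j w) x) := by
    intro j k
    rw [hz1, partialDeriv_add (f := fun x => partialDeriv j η x * w x)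
        (g := fun x => η x * partialDeriv j w x) ((hηd1 j).mul hwd) (hηd.mul (hwd1 j)),
      partialDeriv_mul (hηd1 j) hwd, partialDeriv_mul hηd (hwd1 j)]
  have hoff : ∀ x ∈ Ω, x ∉ ℓ → z =ᶠ[nhds x] w := by
    intro x hx hxℓ
    have hx' : x ∈ (Metric.cthickening (3 * ε) D)ᶜ := fun h => hxℓ ⟨hx, h⟩
    filter_upwards [Metric.isClosed_cthickening.isOpen_compl.mem_nhds hx'] with y hy
    rw [hz]
    simp only
    rw [hηone y fun h => hy (Metric.thickening_subset_cthickening _ _ h), one_mul]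
  have hεinv : ε⁻¹ * ε = 1 := inv_mul_cancel₀ hε0.ne'
  have hon1 : ∀ j, ∀ x ∈ ℓ, |partialDeriv j z x| ≤ Cη * (c + Cw) := by
    intro j x hx
    rw [hz1]
    calc |partialDeriv j η x * w x + η x * partialDeriv j w x|
        ≤ |partialDeriv j η x| * |w x| + |η x| * |partialDeriv j w x| := by
          rw [← abs_mul, ← abs_mul]; exact abs_add_le _ _
      _ ≤ (Cη * ε⁻¹) * (c * ε) + Cη * Cw := by
          gcongr
          · exact hη1 j x
          · exact hwℓ x hx
          · exact hη0 x
          · exact hw1 j x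
      _ = Cη * c * (ε⁻¹ * ε) + Cη * Cw := by ring
      _ = Cη * (c + Cw) := by rw [hεinv]; ring
  -- With two derivatives on the cutoff, `ε⁻²` meets `|w| ≤ c ε`; with one, `ε⁻¹` meets a bounded
  -- gradient. Both are `O(ε⁻¹)`.
  have hon2 : ∀ j k, ∀ x ∈ ℓ, |partialDeriv k (partialDeriv j z) x| ≤
      C2 * ε⁻¹ + Cη * |partialDeriv k (partialDeriv j w) x| := by
    intro j k x hx
    rw [hz11]
    calc |(partialDeriv k (partialDeriv j η) x * w x + partialDeriv j η x * partialDeriv k w x) +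
          (partialDeriv k η x * partialDeriv j w x + η x * partialDeriv k (partialDeriv j w) x)|
        ≤ (|partialDeriv k (partialDeriv j η) x| * |w x| +
            |partialDeriv j η x| * |partialDeriv k w x|) +
          (|partialDeriv k η x| * |partialDeriv j w x| +
            |η x| * |partialDeriv k (partialDeriv j w) x|) := by
          simp only [← abs_mul]
          exact (abs_add_le _ _).trans (add_le_add (abs_add_le _ _) (abs_add_le _ _))
      _ ≤ ((Cη * (ε⁻¹ * ε⁻¹)) * (c * ε) + (Cη * ε⁻¹) * Cw) +
          ((Cη * ε⁻¹) * Cw + Cη * |partialDeriv k (partialDeriv j w) x|) := by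
          gcongr
          · exact hη11 j k x
          · exact hwℓ x hx
          · exact hη1 j x
          · exact hw1 k x
          · exact hη1 k x
          · exact hw1 j x
          · exact hη0 x
      _ = Cη * c * ε⁻¹ * (ε⁻¹ * ε) + 2 * (Cη * Cw) * ε⁻¹ +
          Cη * |partialDeriv k (partialDeriv j w) x| := by ring
      _ = C2 * ε⁻¹ + Cη * |partialDeriv k (partialDeriv j w) x| := by
          rw [hεinv, hC2]; ring
  -- Because `s < 1`, the layer contributions `O(ε)` and `O(1)` are dominated by the interior
  -- bounds.
  have hpow1 : ε ≤ ((2 : ℝ) ^ J) ^ (-s) := by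
    rw [hε, ← Real.rpow_neg_one]
    exact Real.rpow_le_rpow_of_exponent_le (one_le_pow₀ (by norm_num)) (by linarith [hs.2])
  have hpow2 : 1 ≤ ((2 : ℝ) ^ J) ^ (1 - s) :=
    Real.one_le_rpow (one_le_pow₀ (by norm_num)) (by linarith [hs.2])
  have hP1 : 0 ≤ ((2 : ℝ) ^ J) ^ (-s) := by positivity
  have hP2 : 0 ≤ ((2 : ℝ) ^ J) ^ (1 - s) := by positivity
  have hQ1 : 0 ≤ Cw + C1 * (4 * Cl) := by positivity
  have hQ2 : 0 ≤ (1 + Cη) * Cw + C2 * (4 * Cl) := by positivity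
  refine ⟨z, hz2, fun x hx => ?_, fun j => ?_, fun j => ?_, fun j k => ?_⟩
  · rw [hz]
    simp only
    rw [hηD x (Metric.self_subset_thickening hε0 D hx), zero_mul]
  · filter_upwards [hB j] with x hgx hxΩ
    have h1 : |partialDeriv j z x| ≤ Cη * (c + Cw) + Cw := by
      by_cases hxℓ : x ∈ ℓ
      · linarith [hon1 j x hxℓ]
      · rw [(partialDeriv_congr (hoff x hxΩ hxℓ) j).eq_of_nhds]
        have : 0 ≤ Cη * (c + Cw) := by positivity
        linarith [hw1 j x]
    have h2 := abs_sub (partialDeriv j z x) (g j x)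
    linarith
  · have hzc : Continuous (partialDeriv j z) := (contDiff_partialDeriv hz2 j).continuous
    have hwgi : Integrable fun x => |partialDeriv j w x - g j x| := ((hw1i j).sub (hg j)).abs
    have hle : ∀ᵐ x, x ∈ Ω → |partialDeriv j z x - g j x| ≤
        |partialDeriv j w x - g j x| + C1 * ℓ.indicator (fun _ => (1 : ℝ)) x := by
      filter_upwards [hB j] with x hgx hxΩ
      by_cases hxℓ : x ∈ ℓ
      · rw [indicator_of_mem hxℓ, mul_one]
        have h2 := abs_sub (partialDeriv j z x) (g j x)
        have h3 := hon1 j x hxℓ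
        have h4 := abs_nonneg (partialDeriv j w x - g j x)
        linarith
      · rw [indicator_of_notMem hxℓ, mul_zero, add_zero,
          (partialDeriv_congr (hoff x hxΩ hxℓ) j).eq_of_nhds]
    calc ∫ x in Ω, |partialDeriv j z x - g j x|
        ≤ ∫ x in Ω, (|partialDeriv j w x - g j x| + C1 * ℓ.indicator (fun _ => (1 : ℝ)) x) :=
          setIntegral_mono_on_ae
            ((integrableOn_of_continuous_of_isBounded hzc hΩb).sub (hg j).integrableOn).abs
            (hwgi.add (hℓi.const_mul C1)).integrableOn hΩo.measurableSet hle
      _ ≤ ∫ x, (|partialDeriv j w x - g j x| + C1 * ℓ.indicator (fun _ => (1 : ℝ)) x) := by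
          refine setIntegral_le_integral (hwgi.add (hℓi.const_mul C1))
            (Filter.Eventually.of_forall fun x => ?_)
          have : 0 ≤ ℓ.indicator (fun _ => (1 : ℝ)) x := indicator_nonneg (by simp) x
          simp only [Pi.zero_apply]
          positivity
      _ = (∫ x, |partialDeriv j w x - g j x|) + C1 * volume.real ℓ := by
          rw [integral_add hwgi (hℓi.const_mul C1), integral_const_mul, hℓint]
      _ ≤ Cw * ((2 : ℝ) ^ J) ^ (-s) + C1 * (4 * Cl * ((2 : ℝ) ^ J) ^ (-s)) := by
          refine add_le_add (hwg j) (mul_le_mul_of_nonneg_left (hℓvol.trans ?_) hC10)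
          gcongr
      _ = (Cw + C1 * (4 * Cl)) * ((2 : ℝ) ^ J) ^ (-s) := by ring
      _ ≤ _ := mul_le_mul_of_nonneg_right (by linarith) hP1
  · have hzc : Continuous (partialDeriv k (partialDeriv j z)) :=
      ((contDiff_partialDeriv hz2 j).continuous_fderiv (by norm_num)).clm_apply continuous_const
    have hle : ∀ x ∈ Ω, |partialDeriv k (partialDeriv j z) x| ≤
        (1 + Cη) * |partialDeriv k (partialDeriv j w) x| +
          (C2 * ε⁻¹) * ℓ.indicator (fun _ => (1 : ℝ)) x := by
      intro x hxΩ
      have h4 := abs_nonneg (partialDeriv k (partialDeriv j w) x)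
      by_cases hxℓ : x ∈ ℓ
      · rw [indicator_of_mem hxℓ, mul_one]
        linarith [hon2 j k x hxℓ]
      · rw [indicator_of_notMem hxℓ, mul_zero, add_zero,
          (partialDeriv_congr (partialDeriv_congr (hoff x hxΩ hxℓ) j) k).eq_of_nhds]
        nlinarith
    have hi1 := (hw2i j k).abs.const_mul (1 + Cη)
    have hi2 := hℓi.const_mul (C2 * ε⁻¹)
    calc ∫ x in Ω, |partialDeriv k (partialDeriv j z) x|
        ≤ ∫ x in Ω, ((1 + Cη) * |partialDeriv k (partialDeriv j w) x| +
            (C2 * ε⁻¹) * ℓ.indicator (fun _ => (1 : ℝ)) x) :=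
          setIntegral_mono_on (integrableOn_of_continuous_of_isBounded hzc hΩb).abs
            (hi1.add hi2).integrableOn hΩo.measurableSet hle
      _ ≤ ∫ x, ((1 + Cη) * |partialDeriv k (partialDeriv j w) x| +
            (C2 * ε⁻¹) * ℓ.indicator (fun _ => (1 : ℝ)) x) := by
          refine setIntegral_le_integral (hi1.add hi2) (Filter.Eventually.of_forall fun x => ?_)
          have : 0 ≤ ℓ.indicator (fun _ => (1 : ℝ)) x := indicator_nonneg (by simp) x
          simp only [Pi.zero_apply]
          positivity
      _ = (1 + Cη) * (∫ x, |partialDeriv k (partialDeriv j w) x|) +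
            (C2 * ε⁻¹) * volume.real ℓ := by
          rw [integral_add hi1 hi2, integral_const_mul, integral_const_mul, hℓint]
      _ ≤ (1 + Cη) * (Cw * ((2 : ℝ) ^ J) ^ (1 - s)) + (C2 * ε⁻¹) * (4 * Cl * ε) := by
          refine add_le_add (mul_le_mul_of_nonneg_left (hw2b j k) (by positivity))
            (mul_le_mul_of_nonneg_left hℓvol (by positivity))
      _ = (1 + Cη) * Cw * ((2 : ℝ) ^ J) ^ (1 - s) + C2 * (4 * Cl) * (ε⁻¹ * ε) := by ring
      _ ≤ (1 + Cη) * Cw * ((2 : ℝ) ^ J) ^ (1 - s) +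
            C2 * (4 * Cl) * ((2 : ℝ) ^ J) ^ (1 - s) := by
          rw [hεinv]
          gcongr
      _ = ((1 + Cη) * Cw + C2 * (4 * Cl)) * ((2 : ℝ) ^ J) ^ (1 - s) := by ring
      _ ≤ _ := mul_le_mul_of_nonneg_right (by linarith) hP2

end Competitor

/-! ### Upper bound for the energy of a smooth competitor. -/

section Energy

variable {n : ℕ}

lemma continuous_partialDeriv {f : Rn n → ℝ} (hf : ContDiff ℝ 1 f) (j : Fin n) :
    Continuous (partialDeriv j f) :=
  (hf.continuous_fderiv (by norm_num)).clm_apply continuous_const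

lemma hasWeakGradient_of_contDiff {u : Rn n → Rn n} {G : Rn n → Mat n}
    (hu : ∀ i, ContDiff ℝ 1 fun x => u x i)
    (hG : ∀ x i j, G x i j = partialDeriv j (fun y => u y i) x) : HasWeakGradient u G := by
  refine ⟨(contDiff_euclidean.2 hu).continuous.locallyIntegrable, fun i j => ?_,
    fun φ hφ hφc i j => ?_⟩
  · simp_rw [hG]
    exact (continuous_partialDeriv (hu i) j).locallyIntegrable
  · rw [integral_mul_partialDeriv_eq_neg (hu i) hφ hφc j]
    simp_rw [hG]

/-- Integration by parts against a test field whose entries are bounded by one; summing over the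
`n³` entries separately is crude but sufficient. -/
lemma totalVariation_le {G : Rn n → Mat n} (hG : ∀ i j, ContDiff ℝ 1 fun x => G x i j)
    {Ω : Set (Rn n)} (hΩ : MeasurableSet Ω) (hΩb : Bornology.IsBounded Ω) {c : ℝ}
    (hc : ∀ i j k, ∫ x in Ω, |partialDeriv k (fun y => G y i j) x| ≤ c) :
    totalVariation G Ω ≤ ENNReal.ofReal ((n : ℝ) ^ 3 * c) := by
  refine iSup_le fun Φ => iSup_le fun hΦ => iSup_le fun hΦc => iSup_le fun hΦΩ => iSup_le fun hΦ1 =>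
    ENNReal.ofReal_le_ofReal ?_
  have hs : ∀ i j k, ContDiff ℝ ∞ fun x => Φ x i j k := fun i j k =>
    contDiff_pi.1 (contDiff_pi.1 (contDiff_pi.1 hΦ i) j) k
  have hsc : ∀ i j k, HasCompactSupport fun x => Φ x i j k := fun i j k =>
    hΦc.comp_left (g := fun a : Fin n → Fin n → Fin n → ℝ => a i j k) rfl
  have h1 : ∀ i j k x, |Φ x i j k| ≤ 1 := fun i j k x => by
    refine abs_le_one_iff_mul_self_le_one.2 ((le_of_eq (sq _).symm).trans (le_trans ?_ (hΦ1 x)))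
    calc Φ x i j k ^ 2 ≤ ∑ k, Φ x i j k ^ 2 :=
          Finset.single_le_sum (f := fun k => Φ x i j k ^ 2) (fun _ _ => sq_nonneg _)
            (Finset.mem_univ k)
      _ ≤ ∑ j, ∑ k, Φ x i j k ^ 2 :=
          Finset.single_le_sum (f := fun j => ∑ k, Φ x i j k ^ 2)
            (fun _ _ => Finset.sum_nonneg fun _ _ => sq_nonneg _) (Finset.mem_univ j)
      _ ≤ ∑ i, ∑ j, ∑ k, Φ x i j k ^ 2 :=
          Finset.single_le_sum (f := fun i => ∑ j, ∑ k, Φ x i j k ^ 2)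
            (fun _ _ => Finset.sum_nonneg fun _ _ => Finset.sum_nonneg fun _ _ => sq_nonneg _)
            (Finset.mem_univ i)
  have h0 : ∀ i j k, ∀ x ∉ Ω, Φ x i j k = 0 := fun i j k x hx => by
    rw [image_eq_zero_of_notMem_tsupport fun h => hx (hΦΩ h)]
    rfl
  have hint : ∀ i j k, Integrable fun x => G x i j * partialDeriv k (fun y => Φ y i j k) x := by
    intro i j k
    refine Continuous.integrable_of_hasCompactSupport ((hG i j).continuous.mul
      (continuous_partialDeriv ((hs i j k).of_le (by norm_num)) k)) ?_
    exact ((hsc i j k).fderiv_apply ℝ (EuclideanSpace.single k 1)).mul_left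
  rw [integral_finsetSum _ fun i _ => integrable_finsetSum _ fun j _ =>
    integrable_finsetSum _ fun k _ => hint i j k]
  calc ∑ i, ∫ x, ∑ j, ∑ k, G x i j * partialDeriv k (fun y => Φ y i j k) x
      = ∑ i, ∑ j, ∑ k, ∫ x, G x i j * partialDeriv k (fun y => Φ y i j k) x := by
        refine Finset.sum_congr rfl fun i _ => ?_
        rw [integral_finsetSum _ fun j _ => integrable_finsetSum _ fun k _ => hint i j k]
        exact Finset.sum_congr rfl fun j _ => integral_finsetSum _ fun k _ => hint i j k
    _ ≤ ∑ _i : Fin n, ∑ _j : Fin n, ∑ _k : Fin n, c := by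
        refine Finset.sum_le_sum fun i _ => Finset.sum_le_sum fun j _ =>
          Finset.sum_le_sum fun k _ => le_trans ?_ (hc i j k)
        have hcont := continuous_partialDeriv (hG i j) k
        rw [integral_mul_partialDeriv_eq_neg (hG i j) (hs i j k) (hsc i j k) k,
          ← setIntegral_eq_integral_of_forall_compl_eq_zero (s := Ω) fun x hx => by
            rw [h0 i j k x hx, mul_zero]]
        refine (neg_le_abs _).trans ((abs_integral_le_integral_abs).trans ?_)
        refine setIntegral_mono_on (integrableOn_of_continuous_of_isBounded
          (hcont.mul (hs i j k).continuous) hΩb).abs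
          (integrableOn_of_continuous_of_isBounded hcont hΩb).abs hΩ fun x _ => ?_
        rw [abs_mul]
        exact mul_le_of_le_one_right (abs_nonneg _) (h1 i j k x)
    _ = (n : ℝ) ^ 3 * c := by simp; ring

section Frobenius

open scoped Matrix.Norms.Frobenius

lemma matDist_nonneg (A : Mat n) (K : Set (Mat n)) : 0 ≤ matDist A K := Metric.infDist_nonneg

lemma matDist_sq_le {A A' : Mat n} {K : Set (Mat n)} (h : A' ∈ K) :
    matDist A K ^ 2 ≤ ∑ i, ∑ j, (A i j - A' i j) ^ 2 := by
  have h1 : matDist A K ≤ ‖A - A'‖ := by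
    rw [← dist_eq_norm]
    exact Metric.infDist_le_dist_of_mem h
  refine (pow_le_pow_left₀ (matDist_nonneg A K) h1 2).trans (le_of_eq ?_)
  rw [Matrix.frobenius_norm_def, ← Real.sqrt_eq_rpow, Real.sq_sqrt (by positivity)]
  simp

end Frobenius

lemma partialDeriv_affine (M : Mat n) (i j : Fin n) (c : ℝ) (x : Rn n) :
    partialDeriv j (fun y => Matrix.toEuclideanLin M y i + c) x = M i j := by
  have h : HasFDerivAt (fun y => Matrix.toEuclideanLin M y i + c)
      ((EuclideanSpace.proj i : Rn n →L[ℝ] ℝ) ∘L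
        LinearMap.toContinuousLinearMap (Matrix.toEuclideanLin M)) x :=
    ((EuclideanSpace.proj i : Rn n →L[ℝ] ℝ) ∘L
      LinearMap.toContinuousLinearMap (Matrix.toEuclideanLin M)).hasFDerivAt.add_const c
  rw [partialDeriv, h.fderiv]
  simp [Matrix.toLpLin_apply]

lemma contDiff_affine (M : Mat n) (i : Fin n) (c : ℝ) {m : WithTop ℕ∞} :
    ContDiff ℝ m (fun y => Matrix.toEuclideanLin M y i + c) :=
  ((EuclideanSpace.proj i : Rn n →L[ℝ] ℝ) ∘L
    LinearMap.toContinuousLinearMap (Matrix.toEuclideanLin M)).contDiff.add contDiff_const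

/-- An upper bound for the energy of a perturbation of the affine boundary datum. -/
lemma sharpEnergy_le {Ω : Set (Rn n)} (hΩo : IsOpen Ω) (hΩb : Bornology.IsBounded Ω)
    {K : Set (Mat n)} {M : Mat n} {G : Rn n → Mat n} (hG : ∀ᵐ x, x ∈ Ω → G x ∈ K)
    (hGi : ∀ i j, Integrable fun x => G x i j - M i j)
    {z : Fin n → Rn n → ℝ} (hz : ∀ i, ContDiff ℝ 2 (z i))
    (hz0 : ∀ i, ∀ x ∈ (closure Ω)ᶜ, z i x = 0) {C a b ε : ℝ} (hC : 0 ≤ C) (hε : 0 ≤ ε)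
    (ha0 : 0 ≤ a) (hb0 : 0 ≤ b)
    (hb : ∀ i j, ∀ᵐ x, x ∈ Ω → |partialDeriv j (z i) x - (G x i j - M i j)| ≤ C)
    (h1 : ∀ i j, ∫ x in Ω, |partialDeriv j (z i) x - (G x i j - M i j)| ≤ a)
    (h2 : ∀ i j k, ∫ x in Ω, |partialDeriv k (partialDeriv j (z i)) x| ≤ b) :
    sharpEnergy Ω K M ε ≤
      ENNReal.ofReal ((n : ℝ) ^ 2 * (C * a) + ε * ((n : ℝ) ^ 3 * b)) := by
  set u : Rn n → Rn n := fun x => Matrix.toEuclideanLin M x + WithLp.toLp 2 fun i => z i x with hu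
  set H : Rn n → Mat n := fun x i j => M i j + partialDeriv j (z i) x with hH
  have hz1 : ∀ i, ContDiff ℝ 1 (z i) := fun i => (hz i).of_le (by norm_num)
  have hui : ∀ i, (fun x => u x i) = fun x => (Matrix.toEuclideanLin M x i + 0) + z i x := by
    intro i
    funext x
    simp [hu]
  have hW : HasWeakGradient u H := by
    refine hasWeakGradient_of_contDiff (fun i => ?_) fun x i j => ?_
    · rw [hui]
      exact (contDiff_affine M i 0).add (hz1 i)
    · rw [hui, partialDeriv_add ((contDiff_affine M i 0).differentiable one_ne_zero)
        ((hz1 i).differentiable one_ne_zero)]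
      beta_reduce
      rw [partialDeriv_affine]
  have hM : ∀ᵐ x, x ∉ closure Ω → H x = M := Filter.Eventually.of_forall fun x hx => by
    ext i j
    have h0 : z i =ᶠ[nhds x] fun _ => 0 := by
      filter_upwards [isClosed_closure.isOpen_compl.mem_nhds hx] with y hy using hz0 i y hy
    rw [hH]
    simp only
    rw [(partialDeriv_congr h0 j).eq_of_nhds]
    simp [partialDeriv]
  rw [sharpEnergy]
  refine (iInf₂_le_of_le u H (iInf₂_le hW hM)).trans ?_
  rw [ENNReal.ofReal_add (by positivity) (by positivity), ENNReal.ofReal_mul hε]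
  have hHp : ∀ i j, (fun x => H x i j) = fun x => partialDeriv j (z i) x + M i j := fun i j => by
    funext x
    rw [hH]
    ring
  refine add_le_add ?_ (mul_le_mul_right (totalVariation_le (fun i j => ?_) hΩo.measurableSet hΩb
    fun i j k => ?_) _)
  · have hi : ∀ i j, IntegrableOn (fun x => C * |partialDeriv j (z i) x - (G x i j - M i j)|) Ω :=
      fun i j => ((integrableOn_of_continuous_of_isBounded (continuous_partialDeriv (hz1 i) j)
        hΩb).sub (hGi i j).integrableOn).abs.const_mul C
    calc ∫⁻ x in Ω, ENNReal.ofReal (matDist (H x) K ^ 2)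
        ≤ ∫⁻ x in Ω, ENNReal.ofReal
            (∑ i, ∑ j, C * |partialDeriv j (z i) x - (G x i j - M i j)|) := by
          refine lintegral_mono_ae ((ae_restrict_iff' hΩo.measurableSet).2 ?_)
          filter_upwards [hG, ae_all_iff.2 fun i => ae_all_iff.2 (hb i)] with x hGx hbx hx
          refine ENNReal.ofReal_le_ofReal ((matDist_sq_le (hGx hx)).trans ?_)
          refine Finset.sum_le_sum fun i _ => Finset.sum_le_sum fun j _ => ?_
          have : H x i j - G x i j = partialDeriv j (z i) x - (G x i j - M i j) := by
            rw [hH]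
            ring
          -- One factor of the square is bounded by `C`, so only an `L¹` estimate of the gradient
          -- error is needed.
          rw [this, ← sq_abs, sq]
          exact mul_le_mul_of_nonneg_right (hbx i j hx) (abs_nonneg _)
      _ = ENNReal.ofReal (∫ x in Ω,
            ∑ i, ∑ j, C * |partialDeriv j (z i) x - (G x i j - M i j)|) := by
          refine (ofReal_integral_eq_lintegral_ofReal ?_ (Filter.Eventually.of_forall fun x => ?_)).symm
          · exact integrable_finsetSum _ fun i _ => integrable_finsetSum _ fun j _ => hi i j
          · exact Finset.sum_nonneg fun i _ => Finset.sum_nonneg fun j _ => by positivity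
      _ ≤ ENNReal.ofReal ((n : ℝ) ^ 2 * (C * a)) := by
          refine ENNReal.ofReal_le_ofReal ?_
          rw [integral_finsetSum _ fun i _ => integrable_finsetSum _ fun j _ => hi i j]
          calc ∑ i, ∫ x in Ω, ∑ j, C * |partialDeriv j (z i) x - (G x i j - M i j)|
              ≤ ∑ _i : Fin n, ∑ _j : Fin n, C * a := by
                refine Finset.sum_le_sum fun i _ => ?_
                rw [integral_finsetSum _ fun j _ => hi i j]
                refine Finset.sum_le_sum fun j _ => ?_
                rw [integral_const_mul]
                exact mul_le_mul_of_nonneg_left (h1 i j) hC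
            _ = (n : ℝ) ^ 2 * (C * a) := by simp; ring
  · rw [hHp]
    exact (contDiff_partialDeriv (hz i) j).add contDiff_const
  · rw [hHp]
    refine le_trans (le_of_eq ?_) (h2 i j k)
    rw [partialDeriv_add ((contDiff_partialDeriv (hz i) j).differentiable one_ne_zero)
      (differentiable_const _)]
    simp [partialDeriv]

end Energy

/-! ### From the inclusion to approximations, and the conclusion. -/

section Perturbation

variable {n : ℕ}

lemma LocallyIntegrable.euclidean_apply {u : Rn n → Rn n} (hu : LocallyIntegrable u) (i : Fin n) :
    LocallyIntegrable fun x => u x i :=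
  hu.mono ((EuclideanSpace.proj i : Rn n →L[ℝ] ℝ).continuous.comp_aestronglyMeasurable
    hu.aestronglyMeasurable) (Filter.Eventually.of_forall fun x => PiLp.norm_apply_le (u x) i)

/-- Subtracting an affine map from a function subtracts its gradient. -/
lemma HasWeakGradient.isWeakPartialDeriv_sub_affine {u : Rn n → Rn n} {G : Rn n → Mat n}
    (hu : HasWeakGradient u G) (M : Mat n) (c : ℝ) (i j : Fin n) :
    IsWeakPartialDeriv j (fun x => u x i - (Matrix.toEuclideanLin M x i + c))
      (fun x => G x i j - M i j) := by
  intro φ hφ hφc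
  have hφd : HasCompactSupport (partialDeriv j φ) :=
    hφc.fderiv_apply ℝ (EuclideanSpace.single j 1)
  have hφdc : Continuous (partialDeriv j φ) :=
    continuous_partialDeriv (hφ.of_le (by norm_num)) j
  have hac : ContDiff ℝ 1 fun x => Matrix.toEuclideanLin M x i + c := contDiff_affine M i c
  have h1 : Integrable fun x => u x i * partialDeriv j φ x :=
    (LocallyIntegrable.euclidean_apply hu.1 i).integrable_smul_right_of_hasCompactSupport hφdc hφd
  have h2 : Integrable fun x => (Matrix.toEuclideanLin M x i + c) * partialDeriv j φ x :=
    (hac.continuous.mul hφdc).integrable_of_hasCompactSupport hφd.mul_left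
  have h3 : Integrable fun x => G x i j * φ x :=
    (hu.2.1 i j).integrable_smul_right_of_hasCompactSupport hφ.continuous hφc
  have h4 : Integrable fun x => M i j * φ x :=
    (continuous_const.mul hφ.continuous).integrable_of_hasCompactSupport hφc.mul_left
  simp_rw [sub_mul]
  rw [integral_sub h1 h2, integral_sub h3 h4, hu.2.2 φ hφ hφc i j,
    integral_mul_partialDeriv_eq_neg hac hφ hφc j]
  simp_rw [partialDeriv_affine]
  ring

lemma integrable_of_ae_eq_zero_off_closure {f : Rn n → ℝ} (hf : LocallyIntegrable f)
    {Ω : Set (Rn n)} (hΩb : Bornology.IsBounded Ω) (h : ∀ᵐ x, x ∉ closure Ω → f x = 0) :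
    Integrable f :=
  (hf.integrableOn_isCompact hΩb.isCompact_closure).integrable_of_ae_notMem_eq_zero h

lemma IsGivenBy.congr_ae {T : 𝓢'(Rn n, ℂ)} {f f' : Rn n → ℝ} (h : IsGivenBy T f)
    (hf : f =ᵐ[volume] f') : IsGivenBy T f' := by
  refine ⟨h.1.mono ?_ ?_, fun φ hφ => ?_⟩
  · exact h.1.aestronglyMeasurable.congr hf
  · filter_upwards [hf] with x hx
    rw [hx]
  · rw [h.2 φ hφ]
    refine integral_congr_ae ?_
    filter_upwards [hf] with x hx
    rw [hx]

lemma LipschitzWith.eq_zero_of_ae {f : Rn n → ℝ} {L : ℝ≥0} (hf : LipschitzWith L f)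
    {U : Set (Rn n)} (hU : IsOpen U) (h : ∀ᵐ x, x ∈ U → f x = 0) : ∀ x ∈ U, f x = 0 := by
  have := MeasureTheory.Measure.eqOn_open_of_ae_eq (μ := volume) (f := f) (g := fun _ => 0)
    ((ae_restrict_iff' hU.measurableSet).2 h) hU hf.continuous.continuousOn continuousOn_const
  exact this

/-- A Lipschitz function of finite Besov norm, supported in a `C^{1,1}` domain, is approximated by
smooth functions with the same support. -/
lemma exists_approx_of_besovNorm_lt_top {Ω : Set (Rn n)} (hΩ : IsC11Domain Ω)
    (hΩb : Bornology.IsBounded Ω) {χ : Rn n → ℝ} (hχ : IsLPBump χ) {f : Rn n → ℝ}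
    (hfl : LocallyIntegrable f) (hf0 : ∀ᵐ x, x ∉ closure Ω → f x = 0)
    {g : Fin n → Rn n → ℝ} (hgl : ∀ j, LocallyIntegrable (g j))
    (hg0 : ∀ j, ∀ᵐ x, x ∉ closure Ω → g j x = 0) {B : ℝ} (hB0 : 0 ≤ B)
    (hB : ∀ j, ∀ᵐ x, |g j x| ≤ B) (hfg : ∀ j, IsWeakPartialDeriv j f (g j))
    {T : 𝓢'(Rn n, ℂ)} (hT : IsGivenBy T f) {s t : ℝ} (hs : besovNorm χ (1 + s) T < ⊤)
    (ht : t ∈ Set.Ioo (0 : ℝ) 1) (hts : t ≤ s) :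
    ∃ C : ℝ, 0 ≤ C ∧ ∀ J : ℕ, 2 ≤ J → ∃ z : Rn n → ℝ, ContDiff ℝ 2 z ∧
      (∀ x ∈ (closure Ω)ᶜ, z x = 0) ∧
      (∀ j, ∀ᵐ x, x ∈ Ω → |partialDeriv j z x - g j x| ≤ C) ∧
      (∀ j, ∫ x in Ω, |partialDeriv j z x - g j x| ≤ C * ((2 : ℝ) ^ J) ^ (-t)) ∧
      (∀ j k, ∫ x in Ω, |partialDeriv k (partialDeriv j z) x| ≤ C * ((2 : ℝ) ^ J) ^ (1 - t)) := by
  have hfi := integrable_of_ae_eq_zero_off_closure hfl hΩb hf0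
  have hgi := fun j => integrable_of_ae_eq_zero_off_closure (hgl j) hΩb (hg0 j)
  have hfgc := fun j => (hfg j).integral_mul_fderiv hfi (hgi j) hΩb.closure hf0 (hg0 j)
  -- The continuous representative vanishes at every exterior point, as the bound on `w` near the
  -- boundary requires.
  obtain ⟨L, f', hL, hff'⟩ := exists_lipschitzWith_ae_eq hfi hB0 hB hfgc
  have hfi' : Integrable f' := hfi.congr hff'
  have hfgc' : ∀ j, ∀ φ : Rn n → ℂ, ContDiff ℝ ∞ φ →
      ∫ t, (f' t : ℂ) * fderiv ℝ φ t (EuclideanSpace.single j 1) = -∫ t, (g j t : ℂ) * φ t := by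
    intro j φ hφ
    rw [← hfgc j φ hφ]
    refine integral_congr_ae ?_
    filter_upwards [hff'] with x hx
    rw [hx]
  have hf0' : ∀ x ∈ (closure Ω)ᶜ, f' x = 0 := by
    refine LipschitzWith.eq_zero_of_ae hL isClosed_closure.isOpen_compl ?_
    filter_upwards [hff', hf0] with x hx h0 hxΩ
    rw [← hx, h0 hxΩ]
  obtain ⟨S, hS0, hS⟩ := exists_integral_norm_dyadic_le hχ (hT.congr_ae hff') hfi' hs
  -- The dyadic frequencies here are at least one, so decay with exponent `s` implies decay with the
  -- smaller exponent `t`.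
  have hS' : ∀ j : ℕ, ∫ x, ‖schwartzConv (fun x => (f' x : ℂ))
      (hχ.dyadicKernel (j + 1) - hχ.dyadicKernel j) x‖ ≤ S * ((2 : ℝ) ^ (j + 1)) ^ (-(1 + t)) :=
    fun j => (hS j).trans (mul_le_mul_of_nonneg_left
      (Real.rpow_le_rpow_of_exponent_le (one_le_pow₀ (by norm_num)) (by linarith)) hS0)
  obtain ⟨Cw, hCw, happ⟩ := hχ.exists_smooth_approx hfi' hL hgi hB hfgc' ht hS0 hS'
  obtain ⟨Cl, hCl0, hCl⟩ := hΩ.exists_measure_layer_le hΩb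
  exact exists_cutoff_approx hΩ.1 hΩb hCl0 hCl hL hf0' hgi hB0 hB ht hCw happ

lemma exists_ae_abs_le_of_memLp_top {ι : Type*} [Finite ι] {f : ι → Rn n → ℝ}
    (hf : ∀ i, MemLp (f i) ⊤ volume) : ∃ B : ℝ, 0 ≤ B ∧ ∀ i, ∀ᵐ x, |f i x| ≤ B := by
  have : Fintype ι := Fintype.ofFinite ι
  obtain ⟨B, hB0, hB⟩ := exists_nonneg_forall_le_of_finite fun i => (eLpNorm (f i) ⊤ volume).toReal
  refine ⟨B, hB0, fun i => ?_⟩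
  have h1 : ∀ᵐ x, ‖f i x‖ₑ ≤ eLpNorm (f i) ⊤ volume := by
    rw [eLpNorm_exponent_top]
    exact ae_le_eLpNormEssSup
  filter_upwards [h1] with x hx
  have h2 := ENNReal.toReal_mono (hf i).2.ne hx
  rw [toReal_enorm, Real.norm_eq_abs] at h2
  exact h2.trans (hB i)

/-- A power of `2 ^ J` cannot be bounded by a constant multiple of a smaller power. -/
lemma exists_mul_two_pow_rpow_lt {a t : ℝ} (h : a < t) (D : ℝ) :
    ∀ᶠ J : ℕ in Filter.atTop, D * ((2 : ℝ) ^ J) ^ (-t) < (((2 : ℝ) ^ J)⁻¹) ^ a := by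
  have h2 : Filter.Tendsto (fun J : ℕ => ((2 : ℝ) ^ J) ^ (t - a)) Filter.atTop Filter.atTop :=
    (tendsto_rpow_atTop (by linarith)).comp (tendsto_pow_atTop_atTop_of_one_lt (by norm_num))
  filter_upwards [h2.eventually_gt_atTop D] with J hJ
  have hp : (0 : ℝ) < 2 ^ J := by positivity
  rw [Real.inv_rpow hp.le, ← Real.rpow_neg hp.le]
  calc D * ((2 : ℝ) ^ J) ^ (-t) < ((2 : ℝ) ^ J) ^ (t - a) * ((2 : ℝ) ^ J) ^ (-t) :=
        mul_lt_mul_of_pos_right hJ (Real.rpow_pos_of_pos hp _)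
    _ = ((2 : ℝ) ^ J) ^ (-a) := by
        rw [← Real.rpow_add hp]
        ring_nf

end Perturbation

theorem mainTheorem2 {n : ℕ} (Ω : Set (Rn n)) (hΩ : IsC11Domain Ω)
    (hΩb : Bornology.IsBounded Ω)
    (K : Set (Mat n)) (hK : IsCompact K) (hKne : K.Nonempty) (M : Mat n)
    (C μ ε₀ : ℝ) (hC : 1 < C) (hμ : μ ∈ Set.Ioo (0 : ℝ) (1 / 2)) (hε₀ : 0 < ε₀)
    (hlower : ∀ ε ∈ Set.Ioo (0 : ℝ) ε₀,
      ENNReal.ofReal (ε ^ (2 * μ)) ≤ ENNReal.ofReal C * sharpEnergy Ω K M ε)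
    (χ : Rn n → ℝ) (hχ : IsLPBump χ)
    (u : Rn n → Rn n) (G : Rn n → Mat n) (hu : IsInclusionSolution Ω K M u G)
    (b : Rn n) (s : ℝ) (v : Rn n → Rn n)
    (hv : ∀ x, v x = u x - Matrix.toEuclideanLin M x - b)
    (hbesov : MemBesov11 χ (1 + s) v)
    (hsupp : ∀ᵐ x, x ∉ closure Ω → v x = 0)
    (hbdd : ∀ i j, MemLp (fun x => G x i j - M i j) ⊤ volume) :
    s ≤ 2 * μ := by
  obtain ⟨hμ0, hμ2⟩ := hμ
  by_contra! hsμ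
  -- The interval is nonempty because `2μ < 1`. Lowering the exponent below one makes the
  -- second-derivative sums grow geometrically even if `s ≥ 1`.
  obtain ⟨t, hμt, ht⟩ : ∃ t, 2 * μ < t ∧ t < min s 1 :=
    exists_between (lt_min hsμ (by linarith))
  have hts : t ≤ s := (ht.trans_le (min_le_left _ _)).le
  have ht1 : t ∈ Set.Ioo (0 : ℝ) 1 := ⟨by linarith, ht.trans_le (min_le_right _ _)⟩
  obtain ⟨hW, hGK, hGM⟩ := hu
  obtain ⟨B, hB0, hB⟩ := exists_ae_abs_le_of_memLp_top
    (f := fun (p : Fin n × Fin n) x => G x p.1 p.2 - M p.1 p.2) fun p => hbdd p.1 p.2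
  have hGl : ∀ i j, LocallyIntegrable fun x => G x i j - M i j := fun i j =>
    (hW.2.1 i j).sub (locallyIntegrable_const (M i j))
  have hG0 : ∀ i j, ∀ᵐ x, x ∉ closure Ω → G x i j - M i j = 0 := fun i j => by
    filter_upwards [hGM] with x hx hxΩ
    rw [hx hxΩ, sub_self]
  have hvi : ∀ i, (fun x => v x i) = fun x => u x i - (Matrix.toEuclideanLin M x i + b i) := by
    intro i
    funext x
    rw [hv]
    simp
    ring
  have key : ∀ i, ∃ C : ℝ, 0 ≤ C ∧ ∀ J : ℕ, 2 ≤ J → ∃ z : Rn n → ℝ, ContDiff ℝ 2 z ∧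
        (∀ x ∈ (closure Ω)ᶜ, z x = 0) ∧
        (∀ j, ∀ᵐ x, x ∈ Ω → |partialDeriv j z x - (G x i j - M i j)| ≤ C) ∧
        (∀ j, ∫ x in Ω, |partialDeriv j z x - (G x i j - M i j)| ≤ C * ((2 : ℝ) ^ J) ^ (-t)) ∧
        (∀ j k, ∫ x in Ω, |partialDeriv k (partialDeriv j z) x| ≤ C * ((2 : ℝ) ^ J) ^ (1 - t)) := by
    intro i
    obtain ⟨T, hT, hTb⟩ := hbesov i
    refine exists_approx_of_besovNorm_lt_top hΩ hΩb hχ hT.1 ?_ (hGl i) (hG0 i) hB0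
      (fun j => hB (i, j)) (fun j => ?_) hT hTb ht1 hts
    · filter_upwards [hsupp] with x hx hxΩ
      rw [hx hxΩ]
      rfl
    · rw [hvi]
      exact hW.isWeakPartialDeriv_sub_affine M (b i) i j
  choose A hA0 hA using key
  obtain ⟨A', hA'0, hA'⟩ := exists_nonneg_forall_le_of_finite A
  set D : ℝ := (n : ℝ) ^ 2 * (A' * A') + (n : ℝ) ^ 3 * A' with hD
  have henergy : ∀ J : ℕ, 2 ≤ J →
      sharpEnergy Ω K M ((2 : ℝ) ^ J)⁻¹ ≤ ENNReal.ofReal (D * ((2 : ℝ) ^ J) ^ (-t)) := by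
    intro J hJ
    choose z hz hz0 hz1 hz2 hz3 using fun i => hA i J hJ
    have hp : (0 : ℝ) < 2 ^ J := by positivity
    refine (sharpEnergy_le hΩ.1 hΩb hGK
      (fun i j => integrable_of_ae_eq_zero_off_closure (hGl i j) hΩb (hG0 i j)) hz hz0 hA'0
      (inv_nonneg.2 hp.le) (a := A' * ((2 : ℝ) ^ J) ^ (-t)) (b := A' * ((2 : ℝ) ^ J) ^ (1 - t))
      (by positivity) (by positivity) (fun i j => ?_) (fun i j => ?_) (fun i j k => ?_)).trans
      (le_of_eq ?_)
    · filter_upwards [hz1 i j] with x hx hxΩ using (hx hxΩ).trans (hA' i)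
    · exact (hz2 i j).trans (mul_le_mul_of_nonneg_right (hA' i) (by positivity))
    · exact (hz3 i j k).trans (mul_le_mul_of_nonneg_right (hA' i) (by positivity))
    -- With `ε = 2^{-J}` the surface term `ε · 2^{J(1-t)}` equals `2^{-Jt}`, the same order as the
    -- elastic term.
    · rw [sub_eq_add_neg, Real.rpow_add hp, Real.rpow_one, hD]
      congr 1
      field_simp
  have hsmall : ∀ᶠ J : ℕ in Filter.atTop, ((2 : ℝ) ^ J)⁻¹ < ε₀ :=
    (tendsto_inv_atTop_zero.comp (tendsto_pow_atTop_atTop_of_one_lt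
      (by norm_num : (1 : ℝ) < 2))).eventually_lt_const hε₀
  obtain ⟨J, hJ1, hJ2, hJ3⟩ := (hsmall.and ((Filter.eventually_ge_atTop 2).and
    (exists_mul_two_pow_rpow_lt hμt (C * D)))).exists
  have h1 := (hlower _ ⟨by positivity, hJ1⟩).trans (mul_le_mul_right (henergy J hJ2) _)
  rw [← ENNReal.ofReal_mul (by linarith), ENNReal.ofReal_le_ofReal_iff (by positivity),
    ← mul_assoc] at h1
  linarith
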